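/- Let $\ell,T,h,\theta>0$, $C_\theta:=2h\cos\theta/\pi$, and let $\rho_A,\mu,r,\kappa\in L^\infty(0,\ell)$ satisfy, for almost every $x\in(0,\ell)$, $$0<\rho_0\le\rho_A(x)\le\rho_1,\quad 0\le\mu_0\le\mu(x)\le\mu_1,\quad 0<r_0\le r(x)\le r_1,\quad 0<\kappa_0\le\kappa(x)\le\kappa_1 .$$ Let $V=\{v\in H^2(0,\ell): v(0)=v'(0)=0\}$, let $\mathcal H=\{g\in H^1(0,T): g(0)=0\}$ with the norm of $H^1(0,T)$, and write $(\cdot,\cdot)$ for the inner product of $L^2(0,\ell)$. For $g\in\mathcal H$ let $u=u(\cdot,\cdot;g)$ be the weak solution of $$\rho_A u_{tt}+\mu u_t+(r u_{xx}+\kappa u_{xxt})_{xx}=0\ \text{ in }(0,\ell)\times(0,T),\qquad u(x,0)=u_t(x,0)=0,$$ $$u(0,t)=u_x(0,t)=0,\quad (ru_{xx}+\kappa u_{xxt})|_{x=\ell}=M(t):=C_\theta\, g(t),\quad -(ru_{xx}+\kappa u_{xxt})_x|_{x=\ell}=g(t),$$ that is, $u,u_t\in L^2(0,T;V)$, $u(\cdot,0)=0$,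 and for every $v\in V$ the function $(\rho_A u_t,v)$ of $t$ belongs to $H^1(0,T)$, vanishes at $t=0$, and for almost every $t\in(0,T)$ satisfies $$\tfrac{d}{dt}(\rho_A u_t,v)+(\mu u_t,v)+(ru_{xx},v'')+(\kappa u_{xxt},v'')=M(t)v'(\ell)+g(t)v(\ell).$$ Let $\nu\in H^1(0,T)$ and $J(g)=\tfrac12\|u(\ell,\cdot;g)-\nu\|^2_{L^2(0,T)}$ for $g\in\mathcal H$. Then for every $g\in\mathcal H$ this weak solution exists and is unique, and $J$ is Fréchet differentiable on $\mathcal H$. Moreover, for every $g\in\mathcal H$ (in particular for every $g$ with $\|g\|_{H^1(0,T)}\le C_g$, whatever $C_g>0$) the adjoint problem $$\rho_A\varphi_{tt}-\mu\varphi_t+(r\varphi_{xx}-\kappa\varphi_{xxt})_{xx}=0\ \text{ in }(0,\ell)\times(0,T),\qquad \varphi(x,T)=\varphi_t(x,T)=0,$$ $$\varphi(0,t)=\varphi_x(0,t)=0,\quad (r\varphi_{xx}-\kappa\varphi_{xxt})|_{x=\ell}=0,\quad -(r\varphi_{xx}-\kappa\varphi_{xxt})_x|_{x=\ell}=u(\ell,t;g)-\nu(t)$$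 has a unique weak solution $\varphi$ (defined in the same way, with $T$ in place of the initial time), and $$\nabla J(g)(t)=\varphi(\ell,t)+C_\theta\,\varphi_x(\ell,t)\quad\text{for a.e. }t\in(0,T),$$ i.e. $\nabla J(g)\in L^2(0,T)$ and $J(g+\delta g)-J(g)=\int_0^T\nabla J(g)(t)\,\delta g(t)\,dt+o(\|\delta g\|_{H^1(0,T)})$ for $\delta g\in\mathcal H$. -/

import Mathlib

open MeasureTheory Set
open scoped ContDiff

noncomputable section

/-! ### Function spaces on an interval -/

/-- `L²(a,b;E)`. -/
abbrev L2 (E : Type*) [NormedAddCommGroup E] (a b : ℝ) : Type _ :=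
  Lp E 2 (volume.restrict (Ioo a b))

/-- `η ∈ C_c^∞(a,b)`. -/
def IsTestFun (a b : ℝ) (η : ℝ → ℝ) : Prop :=
  ContDiff ℝ ∞ η ∧ HasCompactSupport η ∧ tsupport η ⊆ Ioo a b

theorem L2.integrable_smul {E : Type*} [NormedAddCommGroup E] [NormedSpace ℝ E] {a b : ℝ}
    (f : L2 E a b) {η : ℝ → ℝ} (hη : Continuous η) :
    Integrable (fun t => η t • f t) (volume.restrict (Ioo a b)) := by
  have hf : Integrable f (volume.restrict (Ioo a b)) :=
    (Lp.memLp f).integrable (by norm_num)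
  obtain ⟨C, hC⟩ := (isCompact_Icc (a := a) (b := b)).exists_bound_of_continuousOn hη.continuousOn
  refine hf.bdd_smul C hη.aestronglyMeasurable ?_
  filter_upwards [ae_restrict_mem measurableSet_Ioo] with t ht
  exact hC t (Ioo_subset_Icc_self ht)

/-- `g` is the weak derivative of `f` on `(a,b)`. -/
def IsWeakDeriv {E : Type*} [NormedAddCommGroup E] [NormedSpace ℝ E] {a b : ℝ}
    (f g : L2 E a b) : Prop :=
  ∀ η : ℝ → ℝ, IsTestFun a b η →
    ∫ t in Ioo a b, deriv η t • f t = - ∫ t in Ioo a b, η t • g t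

theorem IsWeakDeriv.zero {E : Type*} [NormedAddCommGroup E] [NormedSpace ℝ E] {a b : ℝ} :
    IsWeakDeriv (0 : L2 E a b) 0 := by
  intro η _
  have h := Lp.coeFn_zero E 2 (volume.restrict (Ioo a b))
  have e : ∀ c : ℝ → ℝ, ∫ t in Ioo a b, c t • (0 : L2 E a b) t = 0 := fun c => by
    rw [integral_congr_ae (g := fun _ => (0 : E)) (by filter_upwards [h] with t ht; rw [ht]; simp)]
    simp
  rw [e, e, neg_zero]

theorem IsWeakDeriv.add {E : Type*} [NormedAddCommGroup E] [NormedSpace ℝ E] {a b : ℝ}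
    {f₁ g₁ f₂ g₂ : L2 E a b} (h₁ : IsWeakDeriv f₁ g₁) (h₂ : IsWeakDeriv f₂ g₂) :
    IsWeakDeriv (f₁ + f₂) (g₁ + g₂) := by
  intro η hη
  have e : ∀ (c : ℝ → ℝ), Continuous c → ∀ p q : L2 E a b,
      ∫ t in Ioo a b, c t • (p + q) t
        = (∫ t in Ioo a b, c t • p t) + ∫ t in Ioo a b, c t • q t := fun c hc p q => by
    rw [← integral_add (p.integrable_smul hc) (q.integrable_smul hc)]
    refine integral_congr_ae ?_
    filter_upwards [Lp.coeFn_add p q] with t ht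
    rw [ht, Pi.add_apply, smul_add]
  rw [e _ (hη.1.continuous_deriv (by simp)), e _ hη.1.continuous, h₁ η hη, h₂ η hη]
  abel

theorem IsWeakDeriv.smul {E : Type*} [NormedAddCommGroup E] [NormedSpace ℝ E] {a b : ℝ}
    {f g : L2 E a b} (s : ℝ) (h : IsWeakDeriv f g) : IsWeakDeriv (s • f) (s • g) := by
  intro η hη
  have e : ∀ (c : ℝ → ℝ) (p : L2 E a b),
      ∫ t in Ioo a b, c t • (s • p) t = s • ∫ t in Ioo a b, c t • p t := fun c p => by
    rw [← integral_smul]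
    refine integral_congr_ae ?_
    filter_upwards [Lp.coeFn_smul s p] with t ht
    rw [ht, Pi.smul_apply, smul_comm]
  rw [e, e, h η hη, smul_neg]

/-- The Sobolev space `H^k(a,b;E)`, as the space of tuples `(f, f', …, f^(k))` of square integrable
functions, each the weak derivative of the one before it.  Its norm is
`(‖f‖² + ‖f'‖² + ⋯ + ‖f^(k)‖²)^{1/2}`. -/
def Sobolev (k : ℕ) (E : Type*) [NormedAddCommGroup E] [NormedSpace ℝ E] (a b : ℝ) :
    Submodule ℝ (PiLp 2 fun _ : Fin (k + 1) => L2 E a b) where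
  carrier := {f | ∀ i : Fin k, IsWeakDeriv (f i.castSucc) (f i.succ)}
  zero_mem' := fun _ => IsWeakDeriv.zero
  add_mem' := fun hf hg i => (hf i).add (hg i)
  smul_mem' := fun s _ hf i => (hf i).smul s

/-- The continuous representative of `f` on `[a,b]` takes the value `y` at `c`. -/
def HasValueAt {E : Type*} [NormedAddCommGroup E] {a b : ℝ} (f : L2 E a b) (c : ℝ) (y : E) :
    Prop :=
  ∃ F : ℝ → E, ContinuousOn F (Icc a b) ∧ F =ᵐ[volume.restrict (Ioo a b)] f ∧ F c = y

theorem HasValueAt.zero {E : Type*} [NormedAddCommGroup E] {a b c : ℝ} :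
    HasValueAt (0 : L2 E a b) c 0 :=
  ⟨fun _ => 0, continuousOn_const, (Lp.coeFn_zero E 2 _).symm, rfl⟩

theorem HasValueAt.add {E : Type*} [NormedAddCommGroup E] {a b c : ℝ} {f g : L2 E a b} {y z : E}
    (hf : HasValueAt f c y) (hg : HasValueAt g c z) : HasValueAt (f + g) c (y + z) := by
  obtain ⟨F, hF, hF', rfl⟩ := hf
  obtain ⟨G, hG, hG', rfl⟩ := hg
  exact ⟨F + G, hF.add hG, (hF'.add hG').trans (Lp.coeFn_add f g).symm, rfl⟩

theorem HasValueAt.smul {E : Type*} [NormedAddCommGroup E] [NormedSpace ℝ E] {a b c : ℝ}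
    {f : L2 E a b} {y : E} (s : ℝ) (hf : HasValueAt f c y) : HasValueAt (s • f) c (s • y) := by
  obtain ⟨F, hF, hF', rfl⟩ := hf
  exact ⟨s • F, hF.const_smul s, (hF'.const_smul s).trans (Lp.coeFn_smul s f).symm, rfl⟩

open Classical in
/-- The value at `c ∈ [a,b]` of the continuous representative of `f` (it exists for `f` in a
Sobolev space of order at least one). -/
def valueAt {E : Type*} [NormedAddCommGroup E] {a b : ℝ} (f : L2 E a b) (c : ℝ) : E :=
  if h : ∃ y, HasValueAt f c y then h.choose else 0

/-! ### Existence and uniqueness of the continuous representative -/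

theorem L2.intervalIntegrable {a b : ℝ} (hab : a < b) (f : L2 ℝ a b) :
    IntervalIntegrable f volume a b := by
  rw [intervalIntegrable_iff_integrableOn_Ioo_of_le hab.le]
  exact (Lp.memLp f).integrable (by norm_num)

/-- Integration by parts against a test function. -/
theorem L2.integral_deriv_mul_primitive {a b : ℝ} (hab : a < b) (g : L2 ℝ a b) {η : ℝ → ℝ}
    (hη : IsTestFun a b η) :
    ∫ t in Ioo a b, deriv η t • (∫ s in a..t, g s) = - ∫ t in Ioo a b, η t • g t := by
  have hg := g.intervalIntegrable hab
  have hη0 : ∀ t, t ∉ Ioo a b → η t = 0 := fun t ht =>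
    image_eq_zero_of_notMem_tsupport fun h => ht (hη.2.2 h)
  have hac := hg.absolutelyContinuousOnInterval_intervalIntegral (c := a) left_mem_uIcc
  have hac' : AbsolutelyContinuousOnInterval η a b :=
    ContDiffOn.absolutelyContinuousOnInterval (hη.1.contDiffOn.of_le (by simp))
  have key := hac'.integral_mul_deriv_eq_deriv_mul hac
  rw [hη0 a (by simp), hη0 b (by simp)] at key
  have e : ∫ x in a..b, η x * deriv (fun x => ∫ s in a..x, g s) x = ∫ x in a..b, η x * g x := by
    refine intervalIntegral.integral_congr_ae ?_
    filter_upwards [hg.ae_hasDerivAt_integral] with x hx hx'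
    rw [(hx (uIoc_subset_uIcc hx') a left_mem_uIcc).deriv]
  rw [e] at key
  simp only [smul_eq_mul]
  rw [← integral_Ioc_eq_integral_Ioo, ← integral_Ioc_eq_integral_Ioo,
    ← intervalIntegral.integral_of_le hab.le, ← intervalIntegral.integral_of_le hab.le, key]
  ring

/-- A function with weak derivative `g` is, up to a constant, the primitive of `g`. -/
theorem IsWeakDeriv.ae_eq_primitive {a b : ℝ} (hab : a < b) {f g : L2 ℝ a b}
    (h : IsWeakDeriv f g) :
    ∃ c : ℝ, f =ᵐ[volume.restrict (Ioo a b)] fun t => c + ∫ s in a..t, g s := by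
  set G : ℝ → ℝ := fun t => ∫ s in a..t, g s with hG
  have hg := g.intervalIntegrable hab
  have hGc : ContinuousOn G (Icc a b) := by
    have := (hg.absolutelyContinuousOnInterval_intervalIntegral (c := a) left_mem_uIcc).continuousOn
    rwa [uIcc_of_le hab.le] at this
  have hGi : ∀ η : ℝ → ℝ, Continuous η → Integrable (fun t => η t • G t)
      (volume.restrict (Ioo a b)) := fun η hη =>
    ((hη.continuousOn.smul hGc).integrableOn_Icc).mono_set Ioo_subset_Icc_self
  have hfi := fun (η : ℝ → ℝ) (hη : Continuous η) => f.integrable_smul hη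
  -- `f - G` is orthogonal to derivatives of test functions
  have h0 : ∀ η, IsTestFun a b η → ∫ t in Ioo a b, deriv η t • (f t - G t) = 0 := by
    intro η hη
    have hc := hη.1.continuous_deriv (by simp)
    simp only [smul_sub]
    rw [integral_sub (hfi _ hc) (hGi _ hc), h η hη, g.integral_deriv_mul_primitive hab hη, sub_self]
  -- a normalised bump
  obtain ⟨η₀, hη₀, hint⟩ : ∃ η₀, IsTestFun a b η₀ ∧ ∫ t in Ioo a b, η₀ t = 1 := by
    let B : ContDiffBump ((a + b) / 2) := ⟨(b - a) / 8, (b - a) / 4, by linarith, by linarith⟩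
    have hs : tsupport (B.normed volume) ⊆ Ioo a b := by
      rw [B.tsupport_normed_eq]
      intro x hx
      rw [Metric.mem_closedBall, Real.dist_eq, abs_le] at hx
      have : B.rOut = (b - a) / 4 := rfl
      constructor <;> linarith [hx.1, hx.2]
    refine ⟨B.normed volume, ⟨B.contDiff_normed, B.hasCompactSupport_normed, hs⟩, ?_⟩
    rw [setIntegral_eq_integral_of_forall_compl_eq_zero, B.integral_normed]
    exact fun x hx => image_eq_zero_of_notMem_tsupport fun h => hx (hs h)
  set c := ∫ t in Ioo a b, η₀ t • (f t - G t) with hc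
  have hfGi : ∀ η : ℝ → ℝ, Continuous η → Integrable (fun t => η t • (f t - G t))
      (volume.restrict (Ioo a b)) := fun η hη => by
    simp only [smul_sub]; exact (hfi _ hη).sub (hGi _ hη)
  refine ⟨c, ?_⟩
  have main : ∀ᵐ x ∂volume, x ∈ Ioo a b → (f x - G x - c) = 0 := by
    refine isOpen_Ioo.ae_eq_zero_of_integral_contDiff_smul_eq_zero ?_ ?_
    · refine IntegrableOn.locallyIntegrableOn ?_
      have := hfGi (fun _ => 1) continuous_const
      simp only [one_smul] at this
      exact this.sub (integrable_const c)
    · intro ψ hψ hψc hψs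
      set s := ∫ t in Ioo a b, ψ t with hs
      set w : ℝ → ℝ := fun t => ψ t - s * η₀ t with hw
      have hwd : ContDiff ℝ ∞ w := hψ.sub (contDiff_const.mul hη₀.1)
      set η : ℝ → ℝ := fun t => ∫ u in a..t, w u with hηdef
      have hηder : ∀ t, HasDerivAt η (w t) t := fun t =>
        hwd.continuous.integral_hasStrictDerivAt a t |>.hasDerivAt
      have hder : deriv η = w := funext fun t => (hηder t).deriv
      have hws : tsupport w ⊆ tsupport ψ ∪ tsupport η₀ := by
        refine closure_minimal ?_ ((isClosed_tsupport _).union (isClosed_tsupport _))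
        intro x hx
        by_contra hx'
        simp only [mem_union, not_or] at hx'
        exact hx (by simp [hw, image_eq_zero_of_notMem_tsupport hx'.1,
          image_eq_zero_of_notMem_tsupport hx'.2])
      have hK : IsCompact (tsupport ψ ∪ tsupport η₀) := hψc.isCompact.union hη₀.2.1.isCompact
      have hKs : tsupport ψ ∪ tsupport η₀ ⊆ Ioo a b := union_subset hψs hη₀.2.2
      -- the compact support lies in some `[a', b']`
      obtain ⟨a', ha', b', hb', hsub⟩ : ∃ a', a < a' ∧ ∃ b', b' < b ∧
          tsupport ψ ∪ tsupport η₀ ⊆ Icc a' b' := by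
        have hne : (tsupport ψ ∪ tsupport η₀).Nonempty := by
          by_contra hne
          rw [not_nonempty_iff_eq_empty, union_empty_iff] at hne
          have : ∀ t, η₀ t = 0 := fun t => image_eq_zero_of_notMem_tsupport (by simp [hne.2])
          simp [this] at hint
        obtain ⟨p, hp, hp'⟩ := hK.exists_isLeast hne
        obtain ⟨q, hq, hq'⟩ := hK.exists_isGreatest hne
        exact ⟨p, (hKs hp).1, q, (hKs hq).2, fun x hx => ⟨hp' hx, hq' hx⟩⟩
      have hw0 : ∀ t, t ∉ Icc a' b' → w t = 0 := fun t ht =>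
        image_eq_zero_of_notMem_tsupport fun hh => ht (hsub (hws hh))
      have htot : ∫ u in a..b, w u = 0 := by
        rw [intervalIntegral.integral_of_le hab.le, integral_Ioc_eq_integral_Ioo]
        have i1 : IntegrableOn ψ (Ioo a b) :=
          (hψ.continuous.continuousOn.integrableOn_Icc).mono_set Ioo_subset_Icc_self
        have i2 : IntegrableOn η₀ (Ioo a b) :=
          (hη₀.1.continuous.continuousOn.integrableOn_Icc).mono_set Ioo_subset_Icc_self
        rw [hw, integral_sub i1 (i2.const_mul s), integral_const_mul, hint, ← hs]
        ring
      have hii : ∀ p q, IntervalIntegrable w volume p q := fun p q =>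
        hwd.continuous.intervalIntegrable p q
      have hηs : ∀ t, t ∉ Icc a' b' → η t = 0 := by
        intro t ht
        rw [mem_Icc, not_and_or, not_le, not_le] at ht
        rcases ht with ht | ht
        · refine intervalIntegral.integral_zero_ae (Filter.Eventually.of_forall fun u hu => hw0 u ?_)
          intro hu'
          have := hu.2
          rcases le_max_iff.1 this with h1 | h1 <;> linarith [hu'.1]
        · have h1 : ∫ u in t..b, w u = 0 := by
            refine intervalIntegral.integral_zero_ae
              (Filter.Eventually.of_forall fun u hu => hw0 u ?_)
            intro hu'
            have := hu.1
            rcases min_lt_iff.1 this with h1 | h1 <;> linarith [hu'.2]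
          have h2 := intervalIntegral.integral_add_adjacent_intervals (hii a t) (hii t b)
          rw [h1, htot, add_zero] at h2
          exact h2
      have hηts : tsupport η ⊆ Icc a' b' := by
        refine closure_minimal ?_ isClosed_Icc
        intro x hx
        by_contra hx'
        exact hx (hηs x hx')
      have hηt : IsTestFun a b η := by
        refine ⟨?_, HasCompactSupport.of_support_subset_isCompact isCompact_Icc
          (subset_closure.trans hηts), hηts.trans (Icc_subset_Ioo ha' hb')⟩
        rw [contDiff_infty_iff_deriv]
        exact ⟨fun t => (hηder t).differentiableAt, hder ▸ hwd⟩
      have h1 := h0 η hηt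
      rw [hder] at h1
      rw [← setIntegral_eq_integral_of_forall_compl_eq_zero (s := Ioo a b)
        (fun x hx => by rw [image_eq_zero_of_notMem_tsupport fun hh => hx (hψs hh), zero_smul])]
      have i1 : IntegrableOn ψ (Ioo a b) :=
        (hψ.continuous.continuousOn.integrableOn_Icc).mono_set Ioo_subset_Icc_self
      have e1 : ∫ t in Ioo a b, ψ t • (f t - G t - c)
          = (∫ t in Ioo a b, ψ t • (f t - G t)) - s * c := by
        simp only [smul_sub _ (_ - _) c]
        rw [integral_sub (hfGi _ hψ.continuous) (i1.smul_const c), integral_smul_const, ← hs,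
          smul_eq_mul]
      have e2 : ∫ t in Ioo a b, w t • (f t - G t)
          = (∫ t in Ioo a b, ψ t • (f t - G t)) - s * c := by
        rw [hc, ← integral_const_mul, ← integral_sub (hfGi _ hψ.continuous)
          ((hfGi _ hη₀.1.continuous).const_mul s)]
        refine integral_congr_ae (Filter.Eventually.of_forall fun t => ?_)
        simp only [hw, smul_eq_mul]
        ring
      rw [e1, ← e2, h1]
  filter_upwards [(ae_restrict_iff' measurableSet_Ioo).2 main] with t ht
  linarith

theorem L2.continuousOn_primitive {a b : ℝ} (hab : a < b) (g : L2 ℝ a b) :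
    ContinuousOn (fun t => ∫ s in a..t, g s) (Icc a b) := by
  have := ((g.intervalIntegrable hab).absolutelyContinuousOnInterval_intervalIntegral
    (c := a) left_mem_uIcc).continuousOn
  rwa [uIcc_of_le hab.le] at this

/-- The value of the continuous representative is unique. -/
theorem HasValueAt.unique {E : Type*} [NormedAddCommGroup E] {a b c : ℝ} (hab : a < b)
    (hc : c ∈ Icc a b) {f : L2 E a b} {y z : E} (hy : HasValueAt f c y) (hz : HasValueAt f c z) :
    y = z := by
  obtain ⟨F, hF, hF', rfl⟩ := hy
  obtain ⟨G, hG, hG', rfl⟩ := hz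
  refine Measure.eqOn_Icc_of_ae_eq volume hab.ne ?_ hF hG hc
  rw [Measure.restrict_congr_set Ioo_ae_eq_Icc.symm]
  exact hF'.trans hG'.symm

/-- A function with a square integrable weak derivative has a continuous representative. -/
theorem IsWeakDeriv.hasValueAt {a b : ℝ} (hab : a < b) {f g : L2 ℝ a b} (h : IsWeakDeriv f g)
    {c : ℝ} : HasValueAt f c (valueAt f c) := by
  have hex : ∃ y, HasValueAt f c y := by
    obtain ⟨d, hd⟩ := h.ae_eq_primitive hab
    exact ⟨_, _, continuousOn_const.add (g.continuousOn_primitive hab), hd.symm, rfl⟩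
  rw [valueAt, dif_pos hex]
  exact hex.choose_spec

theorem IsWeakDeriv.hasValueAt_zero_iff {a b : ℝ} (hab : a < b) {f g : L2 ℝ a b}
    (h : IsWeakDeriv f g) :
    HasValueAt f a 0 ↔ f =ᵐ[volume.restrict (Ioo a b)] fun t => ∫ s in a..t, g s := by
  constructor
  · intro h0
    obtain ⟨d, hd⟩ := h.ae_eq_primitive hab
    have : HasValueAt f a d := ⟨_, continuousOn_const.add (g.continuousOn_primitive hab),
      hd.symm, by simp⟩
    have := this.unique hab (left_mem_Icc.2 hab.le) h0
    subst this
    simpa using hd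
  · intro h0
    exact ⟨_, g.continuousOn_primitive hab, h0.symm, by simp⟩

theorem L2.continuous_setIntegral_smul {a b : ℝ} {η : ℝ → ℝ} (hη : Continuous η) :
    Continuous fun f : L2 ℝ a b => ∫ t in Ioo a b, η t • f t := by
  obtain ⟨C, hC⟩ := (isCompact_Icc (a := a) (b := b)).exists_bound_of_continuousOn hη.continuousOn
  have hm : MemLp η 2 (volume.restrict (Ioo a b)) := by
    refine MemLp.of_bound hη.aestronglyMeasurable C ?_
    filter_upwards [ae_restrict_mem measurableSet_Ioo] with t ht
    exact hC t (Ioo_subset_Icc_self ht)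
  have e : (fun f : L2 ℝ a b => ∫ t in Ioo a b, η t • f t)
      = fun f => inner ℝ (hm.toLp) f := by
    funext f
    rw [L2.inner_def]
    refine integral_congr_ae ?_
    filter_upwards [hm.coeFn_toLp] with t ht
    rw [ht]
    simp [mul_comm]
  rw [e]
  exact continuous_const.inner continuous_id

theorem IsWeakDeriv.isClosed {a b : ℝ} :
    IsClosed {p : L2 ℝ a b × L2 ℝ a b | IsWeakDeriv p.1 p.2} := by
  simp only [IsWeakDeriv, ofPred_forall]
  refine isClosed_iInter fun η => isClosed_iInter fun hη => ?_
  exact isClosed_eq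
    ((L2.continuous_setIntegral_smul (hη.1.continuous_deriv (by simp))).comp continuous_fst)
    ((L2.continuous_setIntegral_smul hη.1.continuous).comp continuous_snd).neg

theorem IsWeakDeriv.isClosed_zero {a b : ℝ} (hab : a < b) :
    IsClosed {p : L2 ℝ a b × L2 ℝ a b | IsWeakDeriv p.1 p.2 ∧ HasValueAt p.1 a 0} := by
  have hset : {p : L2 ℝ a b × L2 ℝ a b | IsWeakDeriv p.1 p.2 ∧ HasValueAt p.1 a 0}
      = {p | IsWeakDeriv p.1 p.2 ∧
        p.1 =ᵐ[volume.restrict (Ioo a b)] fun t => ∫ s in a..t, p.2 s} := by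
    ext p
    exact and_congr_right fun h => h.hasValueAt_zero_iff hab
  rw [hset]
  refine IsSeqClosed.isClosed fun p q hp hpq => ⟨?_, ?_⟩
  · exact IsWeakDeriv.isClosed.isSeqClosed (fun n => (hp n).1) hpq
  have h1 : Filter.Tendsto (fun n => (p n).1) Filter.atTop (nhds q.1) :=
    (continuous_fst.tendsto q).comp hpq
  have h2 : Filter.Tendsto (fun n => (p n).2) Filter.atTop (nhds q.2) :=
    (continuous_snd.tendsto q).comp hpq
  obtain ⟨ns, hns, hae⟩ := (tendstoInMeasure_of_tendsto_Lp h1).exists_seq_tendsto_ae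
  have hall : ∀ᵐ t ∂volume.restrict (Ioo a b), ∀ n, (p n).1 t = ∫ s in a..t, (p n).2 s :=
    ae_all_iff.2 fun n => (hp n).2
  filter_upwards [hae, hall, ae_restrict_mem measurableSet_Ioo] with t ht hall ht'
  refine tendsto_nhds_unique ht ?_
  simp only [hall]
  have hcont : Continuous fun g : L2 ℝ a b => ∫ s in a..t, g s := by
    have hm : volume.restrict (Ioo a b) (Ioc a t) ≠ ⊤ := measure_ne_top _ _
    have e : (fun g : L2 ℝ a b => ∫ s in a..t, g s)
        = fun g => inner ℝ (indicatorConstLp 2 measurableSet_Ioc hm (1 : ℝ)) g := by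
      funext g
      rw [L2.inner_indicatorConstLp_one, intervalIntegral.integral_of_le ht'.1.le,
        Measure.restrict_restrict measurableSet_Ioc,
        inter_eq_left.2 (Ioc_subset_Ioo_right ht'.2)]
    rw [e]
    exact continuous_const.inner continuous_id
  exact ((hcont.tendsto q.2).comp h2).comp hns.tendsto_atTop

/-- The space `{v ∈ H²(0,ℓ) : v(0) = v'(0) = 0}` of deflections of a beam clamped at `0`; the
components of `v` are `v 0 = v`, `v 1 = v'`, `v 2 = v''`. -/
def ClampedH2 (ℓ : ℝ) : Submodule ℝ (PiLp 2 fun _ : Fin 3 => L2 ℝ 0 ℓ) where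
  carrier := {v | v ∈ Sobolev 2 ℝ 0 ℓ ∧ HasValueAt (v 0) 0 0 ∧ HasValueAt (v 1) 0 0}
  zero_mem' := ⟨zero_mem _, HasValueAt.zero, HasValueAt.zero⟩
  add_mem' := fun hf hg => ⟨add_mem hf.1 hg.1,
    by simpa using hf.2.1.add hg.2.1, by simpa using hf.2.2.add hg.2.2⟩
  smul_mem' := fun s _ hf => ⟨Submodule.smul_mem _ s hf.1,
    by simpa using hf.2.1.smul s, by simpa using hf.2.2.smul s⟩

/-- `ClampedH2 ℓ` is a Hilbert space (so that the Bochner integral of functions with values in it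
is the usual one). -/
theorem ClampedH2.completeSpace {ℓ : ℝ} (hℓ : 0 < ℓ) : CompleteSpace (ClampedH2 ℓ) := by
  have hcl : IsClosed (ClampedH2 ℓ : Set (PiLp 2 fun _ : Fin 3 => L2 ℝ 0 ℓ)) := by
    have hset : (ClampedH2 ℓ : Set (PiLp 2 fun _ : Fin 3 => L2 ℝ 0 ℓ))
        = {v | IsWeakDeriv (v 0) (v 1) ∧ HasValueAt (v 0) 0 0} ∩
          {v | IsWeakDeriv (v 1) (v 2) ∧ HasValueAt (v 1) 0 0} := by
      ext v
      constructor
      · rintro ⟨h, h0, h1⟩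
        exact ⟨⟨h 0, h0⟩, ⟨h 1, h1⟩⟩
      · rintro ⟨⟨h, h0⟩, ⟨h', h1⟩⟩
        refine ⟨fun i => ?_, h0, h1⟩
        fin_cases i
        exacts [h, h']
    have hc : ∀ i : Fin 3, Continuous fun v : PiLp 2 fun _ : Fin 3 => L2 ℝ 0 ℓ => v i :=
      fun i => (PiLp.proj 2 (𝕜 := ℝ) (fun _ : Fin 3 => L2 ℝ 0 ℓ) i).continuous
    rw [hset]
    exact ((IsWeakDeriv.isClosed_zero hℓ).preimage ((hc 0).prodMk (hc 1))).inter
      ((IsWeakDeriv.isClosed_zero hℓ).preimage ((hc 1).prodMk (hc 2)))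
  exact hcl.completeSpace_coe

/-- The space `{g ∈ H¹(0,T) : g(0) = 0}` of shear forces, with the norm of `H¹(0,T)`; the
components of `g` are `g 0 = g`, `g 1 = g'`. -/
def ForceSpace (T : ℝ) : Submodule ℝ (PiLp 2 fun _ : Fin 2 => L2 ℝ 0 T) where
  carrier := {g | g ∈ Sobolev 1 ℝ 0 T ∧ HasValueAt (g 0) 0 0}
  zero_mem' := ⟨zero_mem _, HasValueAt.zero⟩
  add_mem' := fun hf hg => ⟨add_mem hf.1 hg.1, by simpa using hf.2.add hg.2⟩
  smul_mem' := fun s _ hf => ⟨Submodule.smul_mem _ s hf.1, by simpa using hf.2.smul s⟩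

/-! ### Weak solutions of the beam equation -/

/-- `∫₀^ℓ w(x) p(x) q(x) dx`. -/
def weightedPairing {ℓ : ℝ} (w : ℝ → ℝ) (p q : L2 ℝ 0 ℓ) : ℝ :=
  ∫ x in Ioo 0 ℓ, w x * p x * q x

/-- The class `H¹(0,T;V)`, `V = ClampedH2 ℓ`, of functions `u(x,t)` with `u, u_t ∈ L²(0,T;V)`.
For `u` in it, `u 0 t ∈ V` is `u(·,t)` and `u 1 t ∈ V` is `u_t(·,t)`. -/
abbrev BeamClass (ℓ T : ℝ) : Type := Sobolev 1 (ClampedH2 ℓ) 0 T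

/-- `u` is a weak solution of
`ρ u_tt + μ u_t + (r u_xx + κ u_xxt)_xx = 0` in `(0,ℓ) × (0,T)`,
`u = u_t = 0` at `t = t₀`, `u = u_x = 0` at `x = 0`,
`r u_xx + κ u_xxt = M` and `-(r u_xx + κ u_xxt)_x = g` at `x = ℓ`, that is: `u(·,t₀) = 0`, and for
every `v ∈ V` the function `(ρ u_t(·,t), v)` of `t` belongs to `H¹(0,T)`, vanishes at `t₀` and, for
almost every `t`,
`d/dt (ρ u_t, v) + (μ u_t, v) + (r u_xx, v'') + (κ u_xxt, v'') = M(t) v'(ℓ) + g(t) v(ℓ)`. -/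
def IsWeakBeamSolution (ℓ T : ℝ) (ρ μ r κ : ℝ → ℝ) (t₀ : ℝ) (M g : ℝ → ℝ)
    (u : BeamClass ℓ T) : Prop :=
  HasValueAt (u.1 0) t₀ 0 ∧
  ∀ v : ClampedH2 ℓ, ∃ m ∈ Sobolev 1 ℝ 0 T,
    (∀ᵐ t ∂volume.restrict (Ioo 0 T), m 0 t = weightedPairing ρ ((u.1 1 t).1 0) (v.1 0)) ∧
    HasValueAt (m 0) t₀ 0 ∧
    ∀ᵐ t ∂volume.restrict (Ioo 0 T),
      m 1 t + weightedPairing μ ((u.1 1 t).1 0) (v.1 0)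
        + weightedPairing r ((u.1 0 t).1 2) (v.1 2)
        + weightedPairing κ ((u.1 1 t).1 2) (v.1 2)
      = M t * valueAt (v.1 1) ℓ + g t * valueAt (v.1 0) ℓ

/-- The output `u(ℓ,t)`. -/
def tip {ℓ T : ℝ} (u : BeamClass ℓ T) (t : ℝ) : ℝ := valueAt ((u.1 0 t).1 0) ℓ

/-- The slope `u_x(ℓ,t)`. -/
def tipSlope {ℓ T : ℝ} (u : BeamClass ℓ T) (t : ℝ) : ℝ := valueAt ((u.1 0 t).1 1) ℓ

/-- The factor `C_θ = 2 h cos θ / π` in `M(t) = 2 h cos θ g(t) / π`. -/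
def momentFactor (h θ : ℝ) : ℝ := 2 * h * Real.cos θ / Real.pi

/-- `u` is a weak solution of the direct problem with shear force `g` and moment
`M(t) = 2 h cos θ g(t) / π`, started from rest at `t = 0`. -/
def IsDirectSolution (ℓ T h θ : ℝ) (ρA μ r κ : ℝ → ℝ) (g : ForceSpace T)
    (u : BeamClass ℓ T) : Prop :=
  IsWeakBeamSolution ℓ T ρA μ r κ 0 (fun t => momentFactor h θ * g.1 0 t) (g.1 0) u

/-- `φ` is a weak solution of the backward problem
`ρ φ_tt - μ φ_t + (r φ_xx - κ φ_xxt)_xx = 0`, `φ = φ_t = 0` at `t = T`, `φ = φ_x = 0` at `x = 0`,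
`r φ_xx - κ φ_xxt = 0` and `-(r φ_xx - κ φ_xxt)_x = p` at `x = ℓ`. -/
def IsBackwardSolution (ℓ T : ℝ) (ρA μ r κ : ℝ → ℝ) (p : ℝ → ℝ) (φ : BeamClass ℓ T) : Prop :=
  IsWeakBeamSolution ℓ T ρA (fun x => -μ x) r (fun x => -κ x) T (fun _ => 0) p φ

open Classical in
/-- The weak solution `u(x,t;g)` of the direct problem. -/
def directSolution (ℓ T h θ : ℝ) (ρA μ r κ : ℝ → ℝ) (g : ForceSpace T) : BeamClass ℓ T :=
  if H : ∃ u, IsDirectSolution ℓ T h θ ρA μ r κ g u then H.choose else 0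

/-- The Tikhonov functional `J(g) = ½ ‖u(ℓ,·;g) - ν‖²` in `L²(0,T)`. -/
def tikhonov (ℓ T h θ : ℝ) (ρA μ r κ : ℝ → ℝ) (ν : Sobolev 1 ℝ 0 T) (g : ForceSpace T) : ℝ :=
  1 / 2 * ∫ t in Ioo 0 T, (tip (directSolution ℓ T h θ ρA μ r κ g) t - ν.1 0 t) ^ 2

/-- The functional `δg ↦ ∫₀^T G(t) δg(t) dt` on the space of shear forces. -/
def integralFunctional {T : ℝ} (G : L2 ℝ 0 T) : ForceSpace T →L[ℝ] ℝ :=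
  (innerSL ℝ G).comp
    ((PiLp.proj 2 (𝕜 := ℝ) (fun _ : Fin 2 => L2 ℝ 0 T) 0).comp (ForceSpace T).subtypeL)

/-- `J` is Fréchet differentiable at `g`, with gradient `G ∈ L²(0,T)`:
`J(g + δg) - J(g) = ∫₀^T G(t) δg(t) dt + o(‖δg‖)` in the norm of `H¹(0,T)`. -/
def HasFrechetGradientAt {T : ℝ} (J : ForceSpace T → ℝ) (G : L2 ℝ 0 T) (g : ForceSpace T) : Prop :=
  HasFDerivAt J (integralFunctional G) g

/-- The basic conditions on the coefficients of the beam. -/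
structure BasicConditions (ℓ : ℝ) (ρA μ r κ : ℝ → ℝ) (ρ₀ ρ₁ μ₀ μ₁ r₀ r₁ κ₀ κ₁ : ℝ) : Prop where
  memLp_ρA : MemLp ρA ⊤ (volume.restrict (Ioo 0 ℓ))
  memLp_μ : MemLp μ ⊤ (volume.restrict (Ioo 0 ℓ))
  memLp_r : MemLp r ⊤ (volume.restrict (Ioo 0 ℓ))
  memLp_κ : MemLp κ ⊤ (volume.restrict (Ioo 0 ℓ))
  ρ₀_pos : 0 < ρ₀
  μ₀_nonneg : 0 ≤ μ₀
  r₀_pos : 0 < r₀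
  κ₀_pos : 0 < κ₀
  bounds : ∀ᵐ x ∂volume.restrict (Ioo 0 ℓ),
    (ρ₀ ≤ ρA x ∧ ρA x ≤ ρ₁) ∧ (μ₀ ≤ μ x ∧ μ x ≤ μ₁) ∧
    (r₀ ≤ r x ∧ r x ≤ r₁) ∧ (κ₀ ≤ κ x ∧ κ x ≤ κ₁)

end

noncomputable section

/-! ### Primitives of square integrable functions -/

section Primitive

variable {E F : Type*} [NormedAddCommGroup E] [NormedAddCommGroup F] {a b : ℝ}

/-! Integrated once in time, the weak formulation becomes a single equation for the velocity w = u_t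
in L²(0,T;V). Let R, K, A represent on V the inertia, damping and stiffness forms, and let I be
integration from 0. Since u = I w and I commutes with operators on V, the direct problem reads L w =
I F with L = R + K I + A I² (`L2.evolution`, `isWeakBeamSolution_iff`).

Testing with the displacement gives ⟨L w, I w⟩ ≥ c‖I w‖². Here ⟨R w, I w⟩ and ⟨A I u, u⟩ are halves
of nonnegative quadratic forms at the final time, while the Kelvin–Voigt term, with κ ≥ κ₀ > 0 and
Poincaré's inequality, makes K coercive. The same estimate holds for the adjoint L† tested with I†w
(`L2.evolution_coercive`, `L2.adjoint_evolution_coercive`). As I and I† are injective, both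
operators are injective. The bound ‖I†y‖ ≤ c⁻¹‖L†y‖ makes L w = I F solvable by Hahn–Banach and
Riesz, and exchanging L and L† solves L†w = I†F
(`ContinuousLinearMap.exists_apply_eq_of_adjoint_bound`).

Because I† is minus integration from T, L† is R − K I_T + A I_T², which is the operator of the
backward problem with reversed damping. Hence forward and backward solutions are dual
(`L2.inner_forward_eq_inner_backward`). The output u(ℓ,·;g) = B g is bounded and linear in g, so J
is quadratic with derivative d ↦ ⟨B g − ν, B d⟩. Duality rewrites it as the pairing of d with ⟨e,
φ⟩, where e represents v ↦ v(ℓ) + C_θ v′(ℓ). -/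

theorem L2.integrable (f : L2 E a b) : Integrable f (volume.restrict (Ioo a b)) :=
  (Lp.memLp f).integrable (by norm_num)

theorem L2.integral_norm_le (f : L2 E a b) :
    ∫ t in Ioo a b, ‖f t‖ ≤ (volume.restrict (Ioo a b)).real univ ^ (1 / 2 : ℝ) * ‖f‖ := by
  have h := eLpNorm_le_eLpNorm_mul_rpow_measure_univ (p := 1) (q := 2) (by norm_num)
    (Lp.aestronglyMeasurable f)
  rw [integral_norm_eq_lintegral_enorm (Lp.aestronglyMeasurable f), ← eLpNorm_one_eq_lintegral_enorm,
    Lp.norm_def, mul_comm, Measure.real, ENNReal.toReal_rpow, ← ENNReal.toReal_mul]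
  refine ENNReal.toReal_mono (ENNReal.mul_ne_top (Lp.eLpNorm_ne_top f) ?_) ?_
  · exact ENNReal.rpow_ne_top_of_nonneg (by norm_num) (measure_ne_top _ _)
  · convert h using 3
    norm_num

theorem L2.intervalIntegrable_restrict (f : L2 E a b) (p q : ℝ) :
    IntervalIntegrable f (volume.restrict (Ioo a b)) p q :=
  f.integrable.intervalIntegrable

variable [NormedSpace ℝ E] [NormedSpace ℝ F]

/-- The primitive of `f` vanishing at `c`, as a function on the line. -/
def L2.primitiveFun (c : ℝ) (f : L2 E a b) (t : ℝ) : E :=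
  ∫ s in c..t, f s ∂volume.restrict (Ioo a b)

/-- Integrating against the restricted measure extends the primitive by constants outside (a,b), so
it is continuous on the whole line and c needs no membership condition. -/
theorem L2.continuous_primitiveFun (c : ℝ) (f : L2 E a b) : Continuous (f.primitiveFun c) :=
  intervalIntegral.continuous_primitive f.intervalIntegrable_restrict c

theorem L2.norm_primitiveFun_le (c : ℝ) (f : L2 E a b) (t : ℝ) :
    ‖f.primitiveFun c t‖ ≤ (volume.restrict (Ioo a b)).real univ ^ (1 / 2 : ℝ) * ‖f‖ := by
  refine le_trans ?_ f.integral_norm_le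
  refine (intervalIntegral.norm_integral_le_integral_norm_uIoc).trans ?_
  exact setIntegral_le_integral f.integrable.norm (Filter.Eventually.of_forall fun _ => norm_nonneg _)

theorem L2.memLp_primitiveFun (c : ℝ) (f : L2 E a b) :
    MemLp (f.primitiveFun c) 2 (volume.restrict (Ioo a b)) :=
  MemLp.of_bound (f.continuous_primitiveFun c).aestronglyMeasurable _
    (Filter.Eventually.of_forall (f.norm_primitiveFun_le c))

theorem L2.primitiveFun_congr {f : L2 E a b} {g : ℝ → E} (h : f =ᵐ[volume.restrict (Ioo a b)] g)
    (c t : ℝ) : f.primitiveFun c t = ∫ s in c..t, g s ∂volume.restrict (Ioo a b) :=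
  intervalIntegral.integral_congr_ae (h.mono fun _ hx _ => hx)

variable (E a b) in
/-- The operator `f ↦ ∫_c^t f` on `L²(a,b;E)`. -/
def L2.primitive (c : ℝ) : L2 E a b →L[ℝ] L2 E a b :=
  LinearMap.mkContinuous
    { toFun := fun f => (f.memLp_primitiveFun c).toLp
      map_add' := fun f g => by
        rw [← MemLp.toLp_add]
        refine MemLp.toLp_congr _ _ (Filter.Eventually.of_forall fun t => ?_)
        rw [L2.primitiveFun_congr (Lp.coeFn_add f g)]
        exact intervalIntegral.integral_add (f.intervalIntegrable_restrict _ _)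
          (g.intervalIntegrable_restrict _ _)
      map_smul' := fun r f => by
        rw [← MemLp.toLp_const_smul]
        refine MemLp.toLp_congr _ _ (Filter.Eventually.of_forall fun t => ?_)
        rw [L2.primitiveFun_congr (Lp.coeFn_smul r f)]
        exact intervalIntegral.integral_smul r _ }
    -- One square root of the length passes from the sup norm to the L² norm; the other is the
    -- Cauchy–Schwarz factor in the sup bound of the primitive.
    ((volume.restrict (Ioo a b)).real univ ^ ((2 : ENNReal).toReal⁻¹) *
      ((volume.restrict (Ioo a b)).real univ ^ (1 / 2 : ℝ))) fun f => by
    rw [mul_assoc]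
    refine Lp.norm_le_of_ae_bound (by positivity) ?_
    filter_upwards [(f.memLp_primitiveFun c).coeFn_toLp] with t ht
    exact ht ▸ f.norm_primitiveFun_le c t

theorem L2.coeFn_primitive (c : ℝ) (f : L2 E a b) :
    L2.primitive E a b c f =ᵐ[volume.restrict (Ioo a b)] f.primitiveFun c :=
  (f.memLp_primitiveFun c).coeFn_toLp

theorem L2.hasValueAt_primitive (c : ℝ) (f : L2 E a b) :
    HasValueAt (L2.primitive E a b c f) c 0 :=
  ⟨f.primitiveFun c, (f.continuous_primitiveFun c).continuousOn, (L2.coeFn_primitive c f).symm,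
    by simp [L2.primitiveFun]⟩

theorem HasValueAt.compLp {f : L2 E a b} {c : ℝ} {y : E} (h : HasValueAt f c y) (L : E →L[ℝ] F) :
    HasValueAt (L.compLp f) c (L y) := by
  obtain ⟨G, hG, hG', rfl⟩ := h
  refine ⟨fun t => L (G t), L.continuous.comp_continuousOn hG, ?_, rfl⟩
  filter_upwards [hG', L.coeFn_compLp f] with t ht ht'
  rw [ht', ht]

variable [CompleteSpace E] [CompleteSpace F]

/-- A bounded operator on E passes through the time integral. With `L = innerSL ℝ v` this reduces
vector-valued statements to scalar ones; with an operator on V it gives the integrated equation its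
form. -/
theorem L2.primitive_compLpL (c : ℝ) (L : E →L[ℝ] F) (f : L2 E a b) :
    L2.primitive F a b c (L.compLpL 2 _ f) = L.compLpL 2 _ (L2.primitive E a b c f) := by
  refine Lp.ext ?_
  filter_upwards [L2.coeFn_primitive c (L.compLpL 2 _ f), L2.coeFn_primitive c f,
    L.coeFn_compLpL (L2.primitive E a b c f)] with t h1 h2 h3
  rw [h1, h3, h2, L2.primitiveFun_congr (L.coeFn_compLpL f)]
  exact L.intervalIntegral_comp_comm (f.intervalIntegrable_restrict _ _)

theorem IsWeakDeriv.compLp {f g : L2 E a b} (h : IsWeakDeriv f g) (L : E →L[ℝ] F) :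
    IsWeakDeriv (L.compLp f) (L.compLp g) := by
  have e : ∀ (η : ℝ → ℝ), Continuous η → ∀ p : L2 E a b,
      ∫ t in Ioo a b, η t • L.compLp p t = L (∫ t in Ioo a b, η t • p t) := fun η hη p => by
    rw [← L.integral_comp_comm (p.integrable_smul hη)]
    refine integral_congr_ae ?_
    filter_upwards [L.coeFn_compLp p] with t ht
    rw [ht, map_smul]
  intro η hη
  rw [e _ (hη.1.continuous_deriv (by simp)), e _ hη.1.continuous, h η hη, map_neg]

end Primitive

/-! ### Scalar primitives and weak derivatives -/

section Real

variable {a b : ℝ}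

theorem L2.primitiveFun_eq (g : L2 ℝ a b) {t : ℝ} (ht : t ∈ Icc a b) :
    g.primitiveFun a t = ∫ s in a..t, g s := by
  rw [L2.primitiveFun, intervalIntegral.integral_of_le ht.1, intervalIntegral.integral_of_le ht.1,
    Measure.restrict_restrict measurableSet_Ioc]
  refine setIntegral_congr_set ?_
  have : (Ioc a t ∩ Ioo a b : Set ℝ) =ᵐ[volume] (Ioc a t ∩ Ioc a b : Set ℝ) :=
    (ae_eq_refl _).inter Ioo_ae_eq_Ioc
  rwa [inter_eq_left.2 (Ioc_subset_Ioc_right ht.2)] at this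

theorem L2.primitiveFun_add {E : Type*} [NormedAddCommGroup E] [NormedSpace ℝ E]
    (g : L2 E a b) (c d t : ℝ) :
    g.primitiveFun c d + g.primitiveFun d t = g.primitiveFun c t :=
  intervalIntegral.integral_add_adjacent_intervals (g.intervalIntegrable_restrict _ _)
    (g.intervalIntegrable_restrict _ _)

theorem IsWeakDeriv.eq_primitive_real (hab : a < b) {c : ℝ} (hc : c ∈ Icc a b) {f g : L2 ℝ a b}
    (h : IsWeakDeriv f g) (h0 : HasValueAt f c 0) : f = L2.primitive ℝ a b c g := by
  obtain ⟨d, hd⟩ := h.ae_eq_primitive hab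
  have hd' : f =ᵐ[volume.restrict (Ioo a b)] fun t => d + g.primitiveFun a t := by
    filter_upwards [hd, ae_restrict_mem measurableSet_Ioo] with t ht ht'
    rw [ht, g.primitiveFun_eq (Ioo_subset_Icc_self ht')]
  have h1 : HasValueAt f c (d + g.primitiveFun a c) :=
    ⟨_, (continuous_const.add (g.continuous_primitiveFun a)).continuousOn, hd'.symm, rfl⟩
  have h2 := h1.unique hab hc h0
  refine Lp.ext ?_
  filter_upwards [hd', L2.coeFn_primitive c g] with t h3 h4
  rw [h3, h4]
  linarith [g.primitiveFun_add a c t]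

theorem L2.isWeakDeriv_primitive_real (hab : a < b) (c : ℝ) (g : L2 ℝ a b) :
    IsWeakDeriv (L2.primitive ℝ a b c g) g := by
  intro η hη
  rw [← g.integral_deriv_mul_primitive hab hη]
  have hη' := hη.1.continuous_deriv (by simp)
  -- Moving the base point from c to a changes the primitive by a constant, which this integral
  -- annihilates.
  have h0 : ∫ t in Ioo a b, deriv η t = 0 := by
    rw [← integral_Ioc_eq_integral_Ioo, ← intervalIntegral.integral_of_le hab.le,
      intervalIntegral.integral_deriv_eq_sub
        (fun x _ => (hη.1.differentiable (by simp)).differentiableAt)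
        (hη'.intervalIntegrable _ _)]
    have hη0 : ∀ t, t ∉ Ioo a b → η t = 0 := fun t ht =>
      image_eq_zero_of_notMem_tsupport fun h => ht (hη.2.2 h)
    rw [hη0 a (by simp), hη0 b (by simp), sub_zero]
  have e : ∫ t in Ioo a b, deriv η t • L2.primitive ℝ a b c g t
      = ∫ t in Ioo a b, (deriv η t • g.primitiveFun a t + deriv η t • g.primitiveFun c a) := by
    refine integral_congr_ae ?_
    filter_upwards [L2.coeFn_primitive c g] with t ht
    rw [ht, ← g.primitiveFun_add c a t, smul_add, add_comm]
  have i1 : IntegrableOn (fun t => deriv η t • g.primitiveFun a t) (Ioo a b) :=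
    ((hη'.smul (g.continuous_primitiveFun a)).continuousOn.integrableOn_Icc).mono_set
      Ioo_subset_Icc_self
  have i2 : IntegrableOn (fun t => deriv η t) (Ioo a b) :=
    (hη'.continuousOn.integrableOn_Icc).mono_set Ioo_subset_Icc_self
  rw [e, integral_add i1 (i2.smul_const _), integral_smul_const, h0, zero_smul, add_zero]
  refine integral_congr_ae ?_
  filter_upwards [ae_restrict_mem measurableSet_Ioo] with t ht
  rw [g.primitiveFun_eq (Ioo_subset_Icc_self ht)]

end Real

/-! ### Primitives with values in a Hilbert space, and their duality -/

section Hilbert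

variable {E F : Type*} [NormedAddCommGroup E] [InnerProductSpace ℝ E] [CompleteSpace E]
  [NormedAddCommGroup F] [InnerProductSpace ℝ F] [CompleteSpace F] {a b : ℝ}

/-- An element of `L²(a,b;E)` is determined by its components. -/
theorem L2.ext_inner {f g : L2 E a b}
    (h : ∀ v : E, (innerSL ℝ v).compLp f = (innerSL ℝ v).compLp g) : f = g := by
  -- The exceptional null set in `h` depends on v, so pointwise testing is unavailable without
  -- separability; integrals over sets are compared instead.
  refine Lp.ext (Integrable.ae_eq_of_forall_setIntegral_eq f g f.integrable g.integrable
    fun s _ _ => ?_)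
  refine ext_inner_left ℝ fun v => ?_
  have e : ∀ p : L2 E a b, inner ℝ v (∫ t in s, p t ∂volume.restrict (Ioo a b))
      = ∫ t in s, (innerSL ℝ v).compLp p t ∂volume.restrict (Ioo a b) := fun p => by
    rw [← innerSL_apply_apply ℝ, ← (innerSL ℝ v).integral_comp_comm p.integrable.integrableOn]
    refine integral_congr_ae (ae_restrict_of_ae ?_)
    filter_upwards [(innerSL ℝ v).coeFn_compLp p] with t ht
    rw [ht]
  rw [e, e, h]

/-- Pairing with each v reduces this to real-valued functions. It trades a differential equation
with a rest condition at c for an equation between L² functions. -/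
theorem L2.isWeakDeriv_and_hasValueAt_zero_iff (hab : a < b) {c : ℝ} (hc : c ∈ Icc a b)
    {f g : L2 E a b} :
    IsWeakDeriv f g ∧ HasValueAt f c 0 ↔ f = L2.primitive E a b c g := by
  constructor
  · rintro ⟨h, h0⟩
    refine L2.ext_inner fun v => ?_
    have h1 := h0.compLp (innerSL ℝ v)
    rw [map_zero] at h1
    rw [(h.compLp (innerSL ℝ v)).eq_primitive_real hab hc h1]
    exact L2.primitive_compLpL c (innerSL ℝ v) g
  · rintro rfl
    refine ⟨fun η hη => ?_, L2.hasValueAt_primitive c g⟩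
    refine ext_inner_left ℝ fun v => ?_
    have e : ∀ (η : ℝ → ℝ), Continuous η → ∀ p : L2 E a b,
        inner ℝ v (∫ t in Ioo a b, η t • p t)
          = ∫ t in Ioo a b, η t • (innerSL ℝ v).compLp p t := fun η hη p => by
      rw [← innerSL_apply_apply ℝ, ← (innerSL ℝ v).integral_comp_comm (p.integrable_smul hη)]
      refine integral_congr_ae ?_
      filter_upwards [(innerSL ℝ v).coeFn_compLp p] with t ht
      rw [ht, map_smul]
    rw [inner_neg_right, e _ (hη.1.continuous_deriv (by simp)), e _ hη.1.continuous]
    have := L2.isWeakDeriv_primitive_real hab c ((innerSL ℝ v).compLpL 2 _ g) η hη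
    rwa [L2.primitive_compLpL] at this

theorem L2.inner_compLpL_left (L : E →L[ℝ] F) (f : L2 E a b) (g : L2 F a b) :
    inner ℝ (L.compLpL 2 _ f) g = inner ℝ f (L.adjoint.compLpL 2 _ g) := by
  rw [L2.inner_def, L2.inner_def]
  refine integral_congr_ae ?_
  filter_upwards [L.coeFn_compLpL f, L.adjoint.coeFn_compLpL g] with t h1 h2
  rw [h1, h2, ContinuousLinearMap.adjoint_inner_right]

/-- Fubini on the triangle s < t. The minus sign comes from the orientation of the integral from b.
-/
theorem L2.inner_primitive_left (f g : L2 E a b) :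
    inner ℝ (L2.primitive E a b a f) g = - inner ℝ f (L2.primitive E a b b g) := by
  set ν := volume.restrict (Ioo a b) with hν
  have hl : ∀ t ∈ Ioo a b, f.primitiveFun a t = ∫ s, (Iio t).indicator f s ∂ν := by
    intro t ht
    rw [L2.primitiveFun, intervalIntegral.integral_of_le ht.1.le,
      integral_indicator measurableSet_Iio, hν, Measure.restrict_restrict measurableSet_Ioc,
      Measure.restrict_restrict measurableSet_Iio]
    refine setIntegral_congr_set ?_
    have : (Ioc a t ∩ Ioo a b : Set ℝ) =ᵐ[volume] (Ioo a t ∩ Ioo a b : Set ℝ) :=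
      Ioo_ae_eq_Ioc.symm.inter (ae_eq_refl _)
    have h2 : Ioo a t ∩ Ioo a b = Iio t ∩ Ioo a b := by
      ext s
      simp only [mem_inter_iff, mem_Ioo, mem_Iio]
      tauto
    rwa [h2] at this
  have hr : ∀ s ∈ Ioo a b, g.primitiveFun b s = - ∫ t, (Ioi s).indicator g t ∂ν := by
    intro s hs
    rw [L2.primitiveFun, intervalIntegral.integral_of_ge hs.2.le,
      integral_indicator measurableSet_Ioi, hν, Measure.restrict_restrict measurableSet_Ioc,
      Measure.restrict_restrict measurableSet_Ioi]
    have h2 : Ioc s b ∩ Ioo a b = Ioi s ∩ Ioo a b := by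
      ext t
      simp only [mem_inter_iff, mem_Ioo, mem_Ioi, mem_Ioc]
      constructor
      · tauto
      · exact fun h => ⟨⟨h.1, h.2.2.le⟩, h.2⟩
    rw [h2]
  have hint : Integrable (fun p : ℝ × ℝ => (inner ℝ (f p.1) (g p.2) : ℝ)) (ν.prod ν) :=
    f.integrable.op_fst_snd (op := fun x y => inner ℝ x y) continuous_inner
      ⟨1, fun x y => by simpa using norm_inner_le_norm (𝕜 := ℝ) x y⟩ g.integrable
  have hmeas : MeasurableSet {p : ℝ × ℝ | p.1 < p.2} := measurableSet_lt measurable_fst measurable_snd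
  have hswap := integral_integral_swap (f := fun s t => {p : ℝ × ℝ | p.1 < p.2}.indicator
    (fun p : ℝ × ℝ => (inner ℝ (f p.1) (g p.2) : ℝ)) (s, t)) (hint.indicator hmeas)
  rw [L2.inner_def, L2.inner_def, ← integral_neg]
  calc ∫ t, inner ℝ (L2.primitive E a b a f t) (g t) ∂ν
      = ∫ t, ∫ s, {p : ℝ × ℝ | p.1 < p.2}.indicator
          (fun p : ℝ × ℝ => (inner ℝ (f p.1) (g p.2) : ℝ)) (s, t) ∂ν ∂ν := by
        refine integral_congr_ae ?_
        filter_upwards [L2.coeFn_primitive a f, ae_restrict_mem measurableSet_Ioo] with t h1 ht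
        rw [h1, hl t ht, real_inner_comm,
          ← integral_inner (f.integrable.indicator measurableSet_Iio)]
        refine integral_congr_ae (Filter.Eventually.of_forall fun s => ?_)
        by_cases hst : s < t <;> simp [indicator, hst, real_inner_comm]
    _ = _ := hswap.symm
    _ = _ := by
        refine integral_congr_ae ?_
        filter_upwards [L2.coeFn_primitive b g, ae_restrict_mem measurableSet_Ioo] with s h1 hs
        rw [h1, hr s hs, inner_neg_right, neg_neg,
          ← integral_inner (g.integrable.indicator measurableSet_Ioi)]
        refine integral_congr_ae (Filter.Eventually.of_forall fun t => ?_)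
        by_cases hst : s < t <;> simp [indicator, hst]

end Hilbert

/-! ### An abstract solvability lemma -/

section Solvability

variable {X : Type*} [NormedAddCommGroup X] [InnerProductSpace ℝ X] [CompleteSpace X]

/-- If `T†` dominates `S†` then `T w = S f` is solvable. -/
theorem ContinuousLinearMap.exists_apply_eq_of_adjoint_bound {T S : X →L[ℝ] X} {C : ℝ} (hC : 0 ≤ C)
    (h : ∀ y, ‖S.adjoint y‖ ≤ C * ‖T.adjoint y‖) (f : X) : ∃ w, T w = S f ∧ ‖w‖ ≤ C * ‖f‖ := by
  set T' : X →ₗ[ℝ] X := T.adjoint.toLinearMap with hT'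
  set ℓ : X →ₗ[ℝ] ℝ := (innerSL ℝ f ∘L S.adjoint).toLinearMap with hℓ
  have hbound : ∀ y, ‖ℓ y‖ ≤ C * ‖f‖ * ‖T' y‖ := fun y => by
    calc ‖ℓ y‖ ≤ ‖f‖ * ‖S.adjoint y‖ := norm_inner_le_norm _ _
      _ ≤ ‖f‖ * (C * ‖T.adjoint y‖) := by gcongr; exact h y
      _ = _ := by rw [hT']; simp only [ContinuousLinearMap.coe_coe]; ring
  have hker : ∀ y, T' y = 0 → ℓ y = 0 := fun y hy => by
    have := hbound y
    rw [hy, norm_zero, mul_zero] at this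
    exact norm_le_zero_iff.1 this
  -- The functional T†y ↦ ⟨f, S†y⟩ is well defined on the range of T† because `hker` kills the
  -- ambiguity in y; σ is a linear section used to write it down.
  obtain ⟨q, hq⟩ : ∃ q : LinearMap.range T' →ₗ[ℝ] ℝ, ∀ y, q (T'.rangeRestrict y) = ℓ y := by
    obtain ⟨σ, hσ⟩ := T'.rangeRestrict.exists_rightInverse_of_surjective T'.range_rangeRestrict
    refine ⟨ℓ ∘ₗ σ, fun y => ?_⟩
    have h1 : T'.rangeRestrict (σ (T'.rangeRestrict y)) = T'.rangeRestrict y :=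
      LinearMap.congr_fun hσ _
    have h2 : T' (σ (T'.rangeRestrict y) - y) = 0 := by
      rw [map_sub, sub_eq_zero]
      exact congrArg Subtype.val h1
    have h3 := hker _ h2
    rwa [map_sub, sub_eq_zero] at h3
  let Q : LinearMap.range T' →L[ℝ] ℝ := q.mkContinuous (C * ‖f‖) fun z => by
    obtain ⟨y, rfl⟩ := T'.surjective_rangeRestrict z
    rw [hq]
    exact hbound y
  -- The Hahn–Banach extension preserves the norm, so its Riesz vector w inherits the bound C‖f‖ and
  -- satisfies ⟨w, T†y⟩ = ⟨f, S†y⟩ for all y.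
  obtain ⟨g, hg, hgn⟩ := exists_extension_norm_eq _ Q
  refine ⟨(InnerProductSpace.toDual ℝ X).symm g, ?_, ?_⟩
  · refine ext_inner_right ℝ fun y => ?_
    rw [← ContinuousLinearMap.adjoint_inner_right, ← ContinuousLinearMap.adjoint_inner_right,
      InnerProductSpace.toDual_symm_apply]
    exact (hg (T'.rangeRestrict y)).trans (hq y)
  · rw [LinearIsometryEquiv.norm_map, hgn]
    exact LinearMap.mkContinuous_norm_le _ (by positivity) _

/-- Injectivity of T makes the chosen solution unique, hence linear in f. -/
theorem ContinuousLinearMap.exists_comp_eq_of_adjoint_bound {T S : X →L[ℝ] X} {C : ℝ} (hC : 0 ≤ C)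
    (h : ∀ y, ‖S.adjoint y‖ ≤ C * ‖T.adjoint y‖) (hT : Function.Injective T) :
    ∃ Λ : X →L[ℝ] X, ∀ f, T (Λ f) = S f := by
  choose Λ hΛ hn using ContinuousLinearMap.exists_apply_eq_of_adjoint_bound hC h
  refine ⟨LinearMap.mkContinuous
    { toFun := Λ
      map_add' := fun f g => hT (by rw [map_add, hΛ, hΛ, hΛ, map_add])
      map_smul' := fun r f => hT (by simp [hΛ]) } C hn, hΛ⟩

omit [CompleteSpace X] in
theorem norm_le_inv_mul_of_coercive {x y : X} {c : ℝ} (hc : 0 < c)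
    (h : c * ‖x‖ ^ 2 ≤ inner ℝ y x) : ‖x‖ ≤ c⁻¹ * ‖y‖ := by
  have h1 := h.trans (real_inner_le_norm y x)
  rcases (norm_nonneg x).eq_or_lt with h0 | h0
  · rw [← h0]; positivity
  · rw [inv_mul_eq_div, le_div_iff₀ hc]
    nlinarith

end Solvability

/-! ### Second order evolution equations integrated in time -/

section Evolution

variable {E : Type*} [NormedAddCommGroup E] [InnerProductSpace ℝ E] [CompleteSpace E] {a b : ℝ}

/-- If the primitive of g vanishes, g is a weak derivative of zero, so it annihilates all test
functions. -/
theorem L2.primitive_injective (hab : a < b) {c : ℝ} (hc : c ∈ Icc a b) :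
    Function.Injective (L2.primitive E a b c) := by
  refine (injective_iff_map_eq_zero _).2 fun g hg => ?_
  have h := (L2.isWeakDeriv_and_hasValueAt_zero_iff hab hc).2 (rfl : _ = L2.primitive E a b c g)
  rw [hg] at h
  refine Lp.ext ?_
  have h0 : ∀ᵐ t ∂volume, t ∈ Ioo a b → g t = 0 := by
    refine isOpen_Ioo.ae_eq_zero_of_integral_contDiff_smul_eq_zero
      (IntegrableOn.locallyIntegrableOn g.integrable) fun η hη hηc hηs => ?_
    have h1 := h.1 η ⟨hη, hηc, hηs⟩
    have h2 := (IsWeakDeriv.zero (E := E)) η ⟨hη, hηc, hηs⟩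
    rw [h1, neg_inj] at h2
    rw [← setIntegral_eq_integral_of_forall_compl_eq_zero (s := Ioo a b)
      (fun x hx => by rw [image_eq_zero_of_notMem_tsupport fun hh => hx (hηs hh), zero_smul]), h2]
    rw [integral_eq_zero_of_ae]
    filter_upwards [Lp.coeFn_zero E 2 (volume.restrict (Ioo a b))] with t ht
    rw [ht]
    simp
  filter_upwards [(ae_restrict_iff' measurableSet_Ioo).2 h0,
    Lp.coeFn_zero E 2 (volume.restrict (Ioo a b))] with t h1 h2
  rw [h1, h2, Pi.zero_apply]

omit [CompleteSpace E] in
theorem L2.inner_compLpL_of_symmetric {B : E →L[ℝ] E} (hB : ∀ u v, inner ℝ (B u) v = inner ℝ u (B v))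
    (f g : L2 E a b) : inner ℝ (B.compLpL 2 _ f) g = inner ℝ f (B.compLpL 2 _ g) := by
  rw [L2.inner_def, L2.inner_def]
  refine integral_congr_ae ?_
  filter_upwards [B.coeFn_compLpL f, B.coeFn_compLpL g] with t h1 h2
  rw [h1, h2, hB]

/-- The primitives from a and from b differ by the constant m = ∫ f, and pairing B f with a constant
yields ⟨B m, m⟩. For symmetric B this gives ⟨B f, ∫ₐ f⟩ = ½⟨B m, m⟩, the integrated form of ⟨B u′,
u⟩ = ½ d/dt ⟨B u, u⟩. -/
theorem L2.inner_compLpL_primitive_sub {B : E →L[ℝ] E} (f : L2 E a b) (hab : a < b) :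
    inner ℝ (B.compLpL 2 _ f) (L2.primitive E a b a f - L2.primitive E a b b f)
      = inner ℝ (B (f.primitiveFun a b)) (f.primitiveFun a b) := by
  have hm : f.primitiveFun a b = ∫ t in Ioo a b, f t := by
    rw [L2.primitiveFun, intervalIntegral.integral_of_le hab.le,
      Measure.restrict_restrict measurableSet_Ioc, inter_eq_right.2 Ioo_subset_Ioc_self]
  have hB : B (f.primitiveFun a b) = ∫ t in Ioo a b, B (f t) := by
    rw [hm, B.integral_comp_comm f.integrable]
  rw [L2.inner_def, real_inner_comm, hB, ← integral_inner (B.integrable_comp f.integrable)]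
  refine integral_congr_ae ?_
  filter_upwards [B.coeFn_compLpL f, L2.coeFn_primitive a f, L2.coeFn_primitive b f,
    Lp.coeFn_sub (L2.primitive E a b a f) (L2.primitive E a b b f)] with t h1 h2 h3 h4
  rw [h1, h4, Pi.sub_apply, h2, h3, ← f.primitiveFun_add a b t, add_sub_cancel_right,
    real_inner_comm]

theorem L2.inner_compLpL_primitive_left {B : E →L[ℝ] E}
    (hB : ∀ u v, inner ℝ (B u) v = inner ℝ u (B v)) (f : L2 E a b) :
    inner ℝ (B.compLpL 2 _ f) (L2.primitive E a b a f)
      = - inner ℝ (B.compLpL 2 _ f) (L2.primitive E a b b f) := by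
  rw [real_inner_comm, L2.inner_primitive_left, L2.primitive_compLpL, ← L2.inner_compLpL_of_symmetric hB]

theorem L2.inner_compLpL_primitive_nonneg (hab : a < b) {B : E →L[ℝ] E}
    (hB : ∀ u v, inner ℝ (B u) v = inner ℝ u (B v)) (hB0 : ∀ u, 0 ≤ inner ℝ (B u) u)
    (f : L2 E a b) : 0 ≤ inner ℝ (B.compLpL 2 _ f) (L2.primitive E a b a f) := by
  have h1 := L2.inner_compLpL_primitive_sub (B := B) f hab
  have h2 := L2.inner_compLpL_primitive_left hB f
  rw [inner_sub_right] at h1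
  linarith [hB0 (f.primitiveFun a b)]

omit [CompleteSpace E] in
theorem L2.inner_compLpL_coercive {B : E →L[ℝ] E} {c : ℝ} (hB : ∀ u, c * ‖u‖ ^ 2 ≤ inner ℝ (B u) u)
    (f : L2 E a b) : c * ‖f‖ ^ 2 ≤ inner ℝ (B.compLpL 2 _ f) f := by
  rw [← real_inner_self_eq_norm_sq, ← real_inner_smul_left, L2.inner_def, L2.inner_def]
  refine integral_mono_ae (L2.integrable_inner _ _) (L2.integrable_inner _ _) ?_
  filter_upwards [B.coeFn_compLpL f, Lp.coeFn_smul c f] with t h1 h2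
  rw [h1, h2, Pi.smul_apply, real_inner_smul_left, real_inner_self_eq_norm_sq]
  exact hB _

/-- The operator `w ↦ R w + K u + A ∫_a^t u`, where `u = ∫_a^t w`: the time integral of
`R u'' + K u' + A u`. -/
def L2.evolution (R K A : E →L[ℝ] E) : L2 E a b →L[ℝ] L2 E a b :=
  R.compLpL 2 _ + K.compLpL 2 _ ∘L L2.primitive E a b a
    + A.compLpL 2 _ ∘L L2.primitive E a b a ∘L L2.primitive E a b a

variable {R K A : E →L[ℝ] E}

theorem L2.adjoint_primitive (f : L2 E a b) :
    (L2.primitive E a b a).adjoint f = - L2.primitive E a b b f := by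
  refine ext_inner_left ℝ fun y => ?_
  rw [ContinuousLinearMap.adjoint_inner_right, L2.inner_primitive_left, inner_neg_right]

/-- Each time integration contributes one sign change under the adjoint. Thus only the damping term,
which contains a single integration, changes sign, exactly as in the backward equation. -/
theorem L2.adjoint_evolution (hR : ∀ u v, inner ℝ (R u) v = inner ℝ u (R v))
    (hK : ∀ u v, inner ℝ (K u) v = inner ℝ u (K v)) (hA : ∀ u v, inner ℝ (A u) v = inner ℝ u (A v))
    (f : L2 E a b) :
    (L2.evolution R K A).adjoint f = R.compLpL 2 _ f - K.compLpL 2 _ (L2.primitive E a b b f)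
      + A.compLpL 2 _ (L2.primitive E a b b (L2.primitive E a b b f)) := by
  refine ext_inner_left ℝ fun y => ?_
  rw [ContinuousLinearMap.adjoint_inner_right]
  simp only [L2.evolution, add_apply, ContinuousLinearMap.comp_apply,
    inner_add_left, inner_add_right, L2.inner_compLpL_of_symmetric hR,
    L2.inner_compLpL_of_symmetric hK, L2.inner_compLpL_of_symmetric hA, L2.inner_primitive_left,
    L2.primitive_compLpL, inner_neg_right, neg_neg, sub_eq_add_neg]

/-- The energy estimate: with test function u = ∫ₐ f, inertia and stiffness contribute nonnegative
end-time terms and damping contributes c‖u‖². -/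
theorem L2.evolution_coercive (hab : a < b) {c : ℝ}
    (hR : ∀ u v, inner ℝ (R u) v = inner ℝ u (R v)) (hR0 : ∀ u, 0 ≤ inner ℝ (R u) u)
    (hK0 : ∀ u, c * ‖u‖ ^ 2 ≤ inner ℝ (K u) u)
    (hA : ∀ u v, inner ℝ (A u) v = inner ℝ u (A v)) (hA0 : ∀ u, 0 ≤ inner ℝ (A u) u)
    (f : L2 E a b) :
    c * ‖L2.primitive E a b a f‖ ^ 2 ≤ inner ℝ (L2.evolution R K A f) (L2.primitive E a b a f) := by
  have h1 := L2.inner_compLpL_primitive_nonneg hab hR hR0 f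
  have h2 := L2.inner_compLpL_coercive hK0 (L2.primitive E a b a f)
  simp only [L2.evolution, add_apply, ContinuousLinearMap.comp_apply,
    inner_add_left]
  have h4 := L2.inner_compLpL_primitive_nonneg hab hA hA0 (L2.primitive E a b a f)
  have h5 : inner ℝ (A.compLpL 2 _ (L2.primitive E a b a (L2.primitive E a b a f)))
      (L2.primitive E a b a f)
      = inner ℝ (A.compLpL 2 _ (L2.primitive E a b a f))
        (L2.primitive E a b a (L2.primitive E a b a f)) := by
    rw [L2.inner_compLpL_of_symmetric hA, real_inner_comm]
  linarith

/-- The same energy estimate in reversed time, tested with −∫_b f, which is the adjoint primitive of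
f. -/
theorem L2.adjoint_evolution_coercive (hab : a < b) {c : ℝ}
    (hR : ∀ u v, inner ℝ (R u) v = inner ℝ u (R v)) (hR0 : ∀ u, 0 ≤ inner ℝ (R u) u)
    (hK : ∀ u v, inner ℝ (K u) v = inner ℝ u (K v)) (hK0 : ∀ u, c * ‖u‖ ^ 2 ≤ inner ℝ (K u) u)
    (hA : ∀ u v, inner ℝ (A u) v = inner ℝ u (A v)) (hA0 : ∀ u, 0 ≤ inner ℝ (A u) u)
    (f : L2 E a b) :
    c * ‖(L2.primitive E a b a).adjoint f‖ ^ 2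
      ≤ inner ℝ ((L2.evolution R K A).adjoint f) ((L2.primitive E a b a).adjoint f) := by
  have h1 := L2.inner_compLpL_primitive_nonneg hab hR hR0 f
  have h2 := L2.inner_compLpL_coercive hK0 (L2.primitive E a b b f)
  have h3 := L2.inner_compLpL_primitive_nonneg hab hA hA0 (L2.primitive E a b b f)
  rw [L2.inner_compLpL_primitive_left hR] at h1
  rw [L2.inner_compLpL_primitive_left hA, L2.inner_compLpL_of_symmetric hA, real_inner_comm] at h3
  rw [L2.adjoint_primitive, L2.adjoint_evolution hR hK hA, norm_neg]
  simp only [inner_neg_right, inner_add_left, inner_sub_left]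
  linarith

theorem L2.evolution_injective (hab : a < b) {c : ℝ} (hc : 0 < c)
    (hR : ∀ u v, inner ℝ (R u) v = inner ℝ u (R v)) (hR0 : ∀ u, 0 ≤ inner ℝ (R u) u)
    (hK0 : ∀ u, c * ‖u‖ ^ 2 ≤ inner ℝ (K u) u)
    (hA : ∀ u v, inner ℝ (A u) v = inner ℝ u (A v)) (hA0 : ∀ u, 0 ≤ inner ℝ (A u) u) :
    Function.Injective (L2.evolution R K A : L2 E a b →L[ℝ] L2 E a b) := by
  refine (injective_iff_map_eq_zero _).2 fun f hf => ?_
  have h := norm_le_inv_mul_of_coercive hc (L2.evolution_coercive hab hR hR0 hK0 hA hA0 f)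
  rw [hf, norm_zero, mul_zero, norm_le_zero_iff] at h
  exact L2.primitive_injective hab (left_mem_Icc.2 hab.le) (h.trans (map_zero _).symm)

theorem L2.adjoint_evolution_injective (hab : a < b) {c : ℝ} (hc : 0 < c)
    (hR : ∀ u v, inner ℝ (R u) v = inner ℝ u (R v)) (hR0 : ∀ u, 0 ≤ inner ℝ (R u) u)
    (hK : ∀ u v, inner ℝ (K u) v = inner ℝ u (K v)) (hK0 : ∀ u, c * ‖u‖ ^ 2 ≤ inner ℝ (K u) u)
    (hA : ∀ u v, inner ℝ (A u) v = inner ℝ u (A v)) (hA0 : ∀ u, 0 ≤ inner ℝ (A u) u) :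
    Function.Injective (L2.evolution R K A : L2 E a b →L[ℝ] L2 E a b).adjoint := by
  refine (injective_iff_map_eq_zero _).2 fun f hf => ?_
  have h := norm_le_inv_mul_of_coercive hc (L2.adjoint_evolution_coercive hab hR hR0 hK hK0 hA hA0 f)
  rw [hf, norm_zero, mul_zero, norm_le_zero_iff, L2.adjoint_primitive, neg_eq_zero] at h
  exact L2.primitive_injective hab (right_mem_Icc.2 hab.le) (h.trans (map_zero _).symm)

/-- Existence comes from coercivity of the adjoint, uniqueness from coercivity of the operator
itself. In the next lemma the operator and its adjoint exchange roles. -/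
theorem L2.exists_evolution_inverse (hab : a < b) {c : ℝ} (hc : 0 < c)
    (hR : ∀ u v, inner ℝ (R u) v = inner ℝ u (R v)) (hR0 : ∀ u, 0 ≤ inner ℝ (R u) u)
    (hK : ∀ u v, inner ℝ (K u) v = inner ℝ u (K v)) (hK0 : ∀ u, c * ‖u‖ ^ 2 ≤ inner ℝ (K u) u)
    (hA : ∀ u v, inner ℝ (A u) v = inner ℝ u (A v)) (hA0 : ∀ u, 0 ≤ inner ℝ (A u) u) :
    ∃ Λ : L2 E a b →L[ℝ] L2 E a b, ∀ f, L2.evolution R K A (Λ f) = L2.primitive E a b a f :=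
  ContinuousLinearMap.exists_comp_eq_of_adjoint_bound (inv_nonneg.2 hc.le)
    (fun f => norm_le_inv_mul_of_coercive hc
      (L2.adjoint_evolution_coercive hab hR hR0 hK hK0 hA hA0 f))
    (L2.evolution_injective hab hc hR hR0 hK0 hA hA0)

theorem L2.exists_adjoint_evolution_eq (hab : a < b) {c : ℝ} (hc : 0 < c)
    (hR : ∀ u v, inner ℝ (R u) v = inner ℝ u (R v)) (hR0 : ∀ u, 0 ≤ inner ℝ (R u) u)
    (hK0 : ∀ u, c * ‖u‖ ^ 2 ≤ inner ℝ (K u) u)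
    (hA : ∀ u v, inner ℝ (A u) v = inner ℝ u (A v)) (hA0 : ∀ u, 0 ≤ inner ℝ (A u) u)
    (f : L2 E a b) :
    ∃ w, (L2.evolution R K A).adjoint w = (L2.primitive E a b a).adjoint f := by
  obtain ⟨w, hw, -⟩ := ContinuousLinearMap.exists_apply_eq_of_adjoint_bound
    (T := (L2.evolution R K A).adjoint) (S := (L2.primitive E a b a).adjoint) (inv_nonneg.2 hc.le)
    (fun y => by
      rw [ContinuousLinearMap.adjoint_adjoint, ContinuousLinearMap.adjoint_adjoint]
      exact norm_le_inv_mul_of_coercive hc (L2.evolution_coercive hab hR hR0 hK0 hA hA0 y)) f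
  exact ⟨w, hw⟩

end Evolution

/-! ### The forms of the beam equation -/

section Forms

variable {ℓ : ℝ}

/-- `v ↦ v⁽ⁱ⁾` as an operator from the clamped deflections to `L²(0,ℓ)`. -/
def ClampedH2.component (ℓ : ℝ) (i : Fin 3) : ClampedH2 ℓ →L[ℝ] L2 ℝ 0 ℓ :=
  PiLp.proj 2 (𝕜 := ℝ) (fun _ : Fin 3 => L2 ℝ 0 ℓ) i ∘L (ClampedH2 ℓ).subtypeL

theorem ClampedH2.eq_primitive (hℓ : 0 < ℓ) (v : ClampedH2 ℓ) :
    v.1 0 = L2.primitive ℝ 0 ℓ 0 (v.1 1) ∧ v.1 1 = L2.primitive ℝ 0 ℓ 0 (v.1 2) :=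
  have h0 : (0 : ℝ) ∈ Icc 0 ℓ := left_mem_Icc.2 hℓ.le
  ⟨(L2.isWeakDeriv_and_hasValueAt_zero_iff hℓ h0).1 ⟨v.2.1 0, v.2.2.1⟩,
    (L2.isWeakDeriv_and_hasValueAt_zero_iff hℓ h0).1 ⟨v.2.1 1, v.2.2.2⟩⟩

/-- Poincaré's inequality for clamped deflections. -/
theorem ClampedH2.exists_norm_sq_le (hℓ : 0 < ℓ) :
    ∃ C : ℝ, 0 < C ∧ ∀ v : ClampedH2 ℓ, ‖v‖ ^ 2 ≤ C * ‖v.1 2‖ ^ 2 := by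
  set N := ‖L2.primitive ℝ 0 ℓ 0‖
  refine ⟨N ^ 4 + N ^ 2 + 1, by positivity, fun v => ?_⟩
  have h0 : ‖v.1 0‖ ≤ N * ‖v.1 1‖ := by
    conv_lhs => rw [(ClampedH2.eq_primitive hℓ v).1]
    exact ContinuousLinearMap.le_opNorm _ _
  have h1 : ‖v.1 1‖ ≤ N * ‖v.1 2‖ := by
    conv_lhs => rw [(ClampedH2.eq_primitive hℓ v).2]
    exact ContinuousLinearMap.le_opNorm _ _
  have h0' : ‖v.1 0‖ ≤ N * (N * ‖v.1 2‖) := h0.trans (by gcongr)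
  change ‖v.1‖ ^ 2 ≤ _
  rw [PiLp.norm_sq_eq_of_L2, Fin.sum_univ_three]
  have e0 := pow_le_pow_left₀ (norm_nonneg _) h0' 2
  have e1 := pow_le_pow_left₀ (norm_nonneg _) h1 2
  linarith

theorem exists_weightedPairing_eq_inner {w : ℝ → ℝ}
    (hw : MemLp w ⊤ (volume.restrict (Ioo 0 ℓ))) :
    ∃ W : L2 ℝ 0 ℓ →L[ℝ] L2 ℝ 0 ℓ, ∀ p q, inner ℝ (W p) q = weightedPairing w p q := by
  refine ⟨(ContinuousLinearMap.mul ℝ ℝ).holderL (volume.restrict (Ioo 0 ℓ)) ⊤ 2 2 hw.toLp,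
    fun p q => ?_⟩
  rw [L2.inner_def, weightedPairing]
  refine integral_congr_ae ?_
  filter_upwards [(ContinuousLinearMap.mul ℝ ℝ).coeFn_holder (r := 2) hw.toLp p, hw.coeFn_toLp]
    with x h1 h2
  rw [ContinuousLinearMap.holderL_apply_apply, h1, h2]
  simp [mul_comm]

/-- Multiplication by the bounded weight, conjugated by the i-th derivative map and its Hilbert
adjoint. -/
theorem exists_form_operator (hℓ : 0 < ℓ) {w : ℝ → ℝ}
    (hw : MemLp w ⊤ (volume.restrict (Ioo 0 ℓ))) (i : Fin 3) :
    ∃ B : ClampedH2 ℓ →L[ℝ] ClampedH2 ℓ,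
      ∀ u v : ClampedH2 ℓ, inner ℝ (B u) v = weightedPairing w (u.1 i) (v.1 i) := by
  have := ClampedH2.completeSpace hℓ
  obtain ⟨W, hW⟩ := exists_weightedPairing_eq_inner hw
  refine ⟨(ClampedH2.component ℓ i).adjoint ∘L W ∘L ClampedH2.component ℓ i, fun u v => ?_⟩
  rw [ContinuousLinearMap.comp_apply, ContinuousLinearMap.adjoint_inner_left,
    ContinuousLinearMap.comp_apply, hW]
  rfl

theorem weightedPairing_comm (w : ℝ → ℝ) (p q : L2 ℝ 0 ℓ) :
    weightedPairing w p q = weightedPairing w q p := by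
  simp only [weightedPairing, mul_right_comm]

theorem weightedPairing_neg (w : ℝ → ℝ) (p q : L2 ℝ 0 ℓ) :
    weightedPairing (fun x => -w x) p q = -weightedPairing w p q := by
  simp only [weightedPairing, neg_mul, integral_neg]

theorem mul_norm_sq_le_weightedPairing {w : ℝ → ℝ} (hw : MemLp w ⊤ (volume.restrict (Ioo 0 ℓ)))
    {c : ℝ} (hc : ∀ᵐ x ∂volume.restrict (Ioo 0 ℓ), c ≤ w x) (p : L2 ℝ 0 ℓ) :
    c * ‖p‖ ^ 2 ≤ weightedPairing w p p := by
  obtain ⟨W, hW⟩ := exists_weightedPairing_eq_inner hw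
  have hint : Integrable (fun x => w x * (p x * p x)) (volume.restrict (Ioo 0 ℓ)) := by
    have h2 : Integrable (fun x => p x * p x) (volume.restrict (Ioo 0 ℓ)) :=
      (Lp.memLp p).integrable_mul (Lp.memLp p)
    exact hw.integrable_mul (memLp_one_iff_integrable.2 h2)
  rw [← real_inner_self_eq_norm_sq, ← real_inner_smul_left, L2.inner_def, weightedPairing]
  simp only [mul_assoc]
  refine integral_mono_ae (L2.integrable_inner _ _) hint ?_
  filter_upwards [hc, Lp.coeFn_smul c p] with x h1 h2
  rw [h2, Pi.smul_apply]
  simp only [RCLike.inner_apply, conj_trivial, smul_eq_mul]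
  nlinarith [mul_self_nonneg (p x)]

theorem IsWeakDeriv.valueAt_right_eq (hℓ : 0 < ℓ) {f g : L2 ℝ 0 ℓ} (h : IsWeakDeriv f g)
    (h0 : HasValueAt f 0 0) : valueAt f ℓ = ∫ x in Ioo 0 ℓ, g x := by
  have h1 : HasValueAt f ℓ (g.primitiveFun 0 ℓ) := by
    refine ⟨_, (g.continuous_primitiveFun 0).continuousOn, ?_, rfl⟩
    rw [(L2.isWeakDeriv_and_hasValueAt_zero_iff hℓ (left_mem_Icc.2 hℓ.le)).1 ⟨h, h0⟩]
    exact (L2.coeFn_primitive 0 g).symm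
  rw [(h.hasValueAt hℓ (c := ℓ)).unique hℓ (right_mem_Icc.2 hℓ.le) h1, L2.primitiveFun,
    intervalIntegral.integral_of_le hℓ.le, Measure.restrict_restrict measurableSet_Ioc,
    inter_eq_right.2 Ioo_subset_Ioc_self]

/-- The value of a deflection, or of its slope, at the free end is a bounded functional. -/
theorem ClampedH2.exists_valueAt_eq_inner (hℓ : 0 < ℓ) :
    ∃ e₀ e₁ : ClampedH2 ℓ, ∀ v : ClampedH2 ℓ,
      valueAt (v.1 0) ℓ = inner ℝ e₀ v ∧ valueAt (v.1 1) ℓ = inner ℝ e₁ v := by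
  have := ClampedH2.completeSpace hℓ
  let o : L2 ℝ 0 ℓ := indicatorConstLp 2 MeasurableSet.univ (measure_ne_top _ _) (1 : ℝ)
  have ho : ∀ i (v : ClampedH2 ℓ), inner ℝ ((ClampedH2.component ℓ i).adjoint o) v
      = ∫ x in Ioo 0 ℓ, v.1 i x := fun i v => by
    rw [ContinuousLinearMap.adjoint_inner_left, L2.inner_indicatorConstLp_one,
      Measure.restrict_univ]
    rfl
  -- The indices are shifted by one: by the clamping, v(ℓ) is the integral of v′ and v′(ℓ) that of
  -- v″, and pairing with the constant `o` integrates.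
  refine ⟨(ClampedH2.component ℓ 1).adjoint o, (ClampedH2.component ℓ 2).adjoint o, fun v => ?_⟩
  rw [ho, ho]
  exact ⟨(v.2.1 0).valueAt_right_eq hℓ v.2.2.1, (v.2.1 1).valueAt_right_eq hℓ v.2.2.2⟩

end Forms

/-! ### Weak solutions as solutions of an operator equation -/

section WeakSolution

section Components

variable {E : Type*} [NormedAddCommGroup E] [InnerProductSpace ℝ E] {a b : ℝ}

theorem L2.coeFn_inner_compLpL (v : E) (B : E →L[ℝ] E) (f : L2 E a b) :
    ∀ᵐ t ∂volume.restrict (Ioo a b),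
      (innerSL ℝ v).compLp (B.compLpL 2 _ f) t = inner ℝ (B (f t)) v := by
  filter_upwards [(innerSL ℝ v).coeFn_compLp (B.compLpL 2 _ f), B.coeFn_compLpL f] with t h1 h2
  rw [h1, h2, innerSL_apply_apply, real_inner_comm]

theorem L2.coeFn_inner_residual (v : E) (K A : E →L[ℝ] E) (F w u : L2 E a b) {M g : ℝ → ℝ}
    {e₀ e₁ : E} (hF : ∀ᵐ t ∂volume.restrict (Ioo a b), F t = M t • e₁ + g t • e₀) :
    ∀ᵐ t ∂volume.restrict (Ioo a b),
      (innerSL ℝ v).compLp (F - K.compLpL 2 _ w - A.compLpL 2 _ u) t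
        = M t * inner ℝ e₁ v + g t * inner ℝ e₀ v - inner ℝ (K (w t)) v - inner ℝ (A (u t)) v := by
  filter_upwards [(innerSL ℝ v).coeFn_compLp (F - K.compLpL 2 _ w - A.compLpL 2 _ u),
    K.coeFn_compLpL w, A.coeFn_compLpL u,
    Lp.coeFn_sub (F - K.compLpL 2 _ w) (A.compLpL 2 _ u),
    Lp.coeFn_sub F (K.compLpL 2 _ w), hF] with t h0 h1 h2 h3 h4 h5
  rw [h0, h3, Pi.sub_apply, h4, Pi.sub_apply, h1, h2, h5, innerSL_apply_apply, real_inner_comm,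
    inner_sub_left, inner_sub_left, inner_add_left, real_inner_smul_left, real_inner_smul_left]

/-- The weak formulation is stated for one v at a time; this assembles those scalar equations into
one equation in L²(a,b;E). -/
theorem L2.eq_primitive_iff_forall_inner [CompleteSpace E] (hab : a < b) {c : ℝ}
    (hc : c ∈ Icc a b) {f g : L2 E a b} :
    f = L2.primitive E a b c g ↔ ∀ v : E,
      IsWeakDeriv ((innerSL ℝ v).compLp f) ((innerSL ℝ v).compLp g) ∧
      HasValueAt ((innerSL ℝ v).compLp f) c 0 := by
  simp only [L2.isWeakDeriv_and_hasValueAt_zero_iff hab hc]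
  have h : ∀ v : E, L2.primitive ℝ a b c ((innerSL ℝ v).compLp g)
      = (innerSL ℝ v).compLp (L2.primitive E a b c g) := fun v =>
    L2.primitive_compLpL c (innerSL ℝ v) g
  simp only [h]
  exact ⟨fun hf v => hf ▸ rfl, L2.ext_inner⟩

end Components

variable {ℓ T : ℝ}

/-- The weak formulation, integrated in time. -/
theorem isWeakBeamSolution_iff (hℓ : 0 < ℓ) (hT : 0 < T) {ρ μ r κ : ℝ → ℝ}
    {R K A : ClampedH2 ℓ →L[ℝ] ClampedH2 ℓ} {e₀ e₁ : ClampedH2 ℓ}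
    (hR : ∀ u v : ClampedH2 ℓ, inner ℝ (R u) v = weightedPairing ρ (u.1 0) (v.1 0))
    (hK : ∀ u v : ClampedH2 ℓ, inner ℝ (K u) v
      = weightedPairing μ (u.1 0) (v.1 0) + weightedPairing κ (u.1 2) (v.1 2))
    (hA : ∀ u v : ClampedH2 ℓ, inner ℝ (A u) v = weightedPairing r (u.1 2) (v.1 2))
    (he : ∀ v : ClampedH2 ℓ, valueAt (v.1 0) ℓ = inner ℝ e₀ v ∧ valueAt (v.1 1) ℓ = inner ℝ e₁ v)
    {c : ℝ} (hc : c ∈ Icc 0 T) {M g : ℝ → ℝ} {F : L2 (ClampedH2 ℓ) 0 T}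
    (hF : ∀ᵐ t ∂volume.restrict (Ioo 0 T), F t = M t • e₁ + g t • e₀) (u : BeamClass ℓ T) :
    IsWeakBeamSolution ℓ T ρ μ r κ c M g u ↔
      u.1 0 = L2.primitive _ 0 T c (u.1 1) ∧
      R.compLpL 2 _ (u.1 1) = L2.primitive _ 0 T c
        (F - K.compLpL 2 _ (u.1 1) - A.compLpL 2 _ (u.1 0)) := by
  have := ClampedH2.completeSpace hℓ
  set N : L2 (ClampedH2 ℓ) 0 T := F - K.compLpL 2 _ (u.1 1) - A.compLpL 2 _ (u.1 0) with hN
  have hL : ∀ v : ClampedH2 ℓ, ∀ᵐ t ∂volume.restrict (Ioo 0 T),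
      (innerSL ℝ v).compLp (R.compLpL 2 _ (u.1 1)) t
        = weightedPairing ρ ((u.1 1 t).1 0) (v.1 0) := fun v => by
    filter_upwards [L2.coeFn_inner_compLpL v R (u.1 1)] with t h1
    rw [h1, hR]
  have hNL : ∀ v : ClampedH2 ℓ, ∀ᵐ t ∂volume.restrict (Ioo 0 T),
      (innerSL ℝ v).compLp N t
        + weightedPairing μ ((u.1 1 t).1 0) (v.1 0)
        + weightedPairing r ((u.1 0 t).1 2) (v.1 2)
        + weightedPairing κ ((u.1 1 t).1 2) (v.1 2)
        = M t * valueAt (v.1 1) ℓ + g t * valueAt (v.1 0) ℓ := fun v => by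
    filter_upwards [L2.coeFn_inner_residual v K A F (u.1 1) (u.1 0) hF] with t h1
    rw [h1, hK, hA, (he v).1, (he v).2]
    ring
  have hstart : HasValueAt (u.1 0) c 0 ↔ u.1 0 = L2.primitive _ 0 T c (u.1 1) := by
    rw [← L2.isWeakDeriv_and_hasValueAt_zero_iff hT hc]
    exact (and_iff_right (u.2 0)).symm
  rw [IsWeakBeamSolution, hstart]
  refine and_congr_right fun _ => Iff.trans (forall_congr' fun v => ⟨?_, fun h => ?_⟩)
    (L2.eq_primitive_iff_forall_inner hT hc).symm
  -- The equation determines m: its components must be the pairings with v of R u_t and of the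
  -- residual N. The converse takes these pairings as the witness.
  · rintro ⟨m, hm, hm0, hmc, hm1⟩
    have e0 : m 0 = (innerSL ℝ v).compLp (R.compLpL 2 _ (u.1 1)) := by
      refine Lp.ext ?_
      filter_upwards [hm0, hL v] with t h1 h2
      rw [h1, h2]
    have e1 : m 1 = (innerSL ℝ v).compLp N := by
      refine Lp.ext ?_
      filter_upwards [hm1, hNL v] with t h1 h2
      linarith
    rw [← e0, ← e1]
    exact ⟨hm 0, hmc⟩
  · refine ⟨WithLp.toLp 2 ![(innerSL ℝ v).compLp (R.compLpL 2 _ (u.1 1)),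
      (innerSL ℝ v).compLp N], fun i => ?_, hL v, h.2, hNL v⟩
    fin_cases i
    exact h.1

/-- The motion with velocity `w` that is at rest at time `c`. -/
def BeamClass.ofVelocity (hℓ : 0 < ℓ) (hT : 0 < T) {c : ℝ} (hc : c ∈ Icc 0 T)
    (w : L2 (ClampedH2 ℓ) 0 T) : BeamClass ℓ T :=
  ⟨WithLp.toLp 2 ![L2.primitive _ 0 T c w, w], fun i => by
    have := ClampedH2.completeSpace hℓ
    fin_cases i
    exact ((L2.isWeakDeriv_and_hasValueAt_zero_iff hT hc).2 rfl).1⟩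

theorem BeamClass.ext_velocity {c : ℝ} {u v : BeamClass ℓ T}
    (hu : u.1 0 = L2.primitive _ 0 T c (u.1 1)) (hv : v.1 0 = L2.primitive _ 0 T c (v.1 1))
    (h : u.1 1 = v.1 1) : u = v := by
  refine Subtype.ext (PiLp.ext fun i => ?_)
  fin_cases i
  · change u.1 0 = v.1 0
    rw [hu, hv, h]
  · exact h

end WeakSolution

/-! ### Forward and backward equations in terms of the evolution operator -/

section Duality

variable {E : Type*} [NormedAddCommGroup E] [InnerProductSpace ℝ E] [CompleteSpace E] {a b : ℝ}
  {R K A : E →L[ℝ] E}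

variable (R K A) in
/-- `w` is the velocity in the forward problem with load `F`. -/
def L2.SolvesForward (F w : L2 E a b) : Prop :=
  L2.evolution R K A w = L2.primitive E a b a F

variable (R K A) in
/-- `w` is the velocity in the backward problem with load `F`. -/
def L2.SolvesBackward (F w : L2 E a b) : Prop :=
  (L2.evolution R K A).adjoint w = L2.primitive E a b b F

theorem L2.forward_iff {F w u : L2 E a b} (hu : u = L2.primitive E a b a w) :
    R.compLpL 2 _ w = L2.primitive E a b a (F - K.compLpL 2 _ w - A.compLpL 2 _ u) ↔
      L2.SolvesForward R K A F w := by
  subst hu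
  rw [L2.SolvesForward]
  simp only [L2.evolution, add_apply, ContinuousLinearMap.comp_apply, map_sub,
    L2.primitive_compLpL]
  rw [sub_sub, eq_sub_iff_add_eq, add_assoc]

theorem L2.backward_iff (hR : ∀ u v, inner ℝ (R u) v = inner ℝ u (R v))
    (hK : ∀ u v, inner ℝ (K u) v = inner ℝ u (K v)) (hA : ∀ u v, inner ℝ (A u) v = inner ℝ u (A v))
    {K' : E →L[ℝ] E} (hK' : ∀ u, K' u = -K u)
    {F w u : L2 E a b} (hu : u = L2.primitive E a b b w) :
    R.compLpL 2 _ w = L2.primitive E a b b (F - K'.compLpL 2 _ w - A.compLpL 2 _ u) ↔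
      L2.SolvesBackward R K A F w := by
  subst hu
  rw [L2.SolvesBackward]
  have hneg : K'.compLpL 2 (volume.restrict (Ioo a b)) w = -(K.compLpL 2 _ w) := by
    rw [show K' = -K from ContinuousLinearMap.ext hK', ← neg_one_smul ℝ K, ContinuousLinearMap.smul_compLpL, smul_apply, neg_one_smul]
  rw [L2.adjoint_evolution hR hK hA, hneg]
  simp only [map_sub, map_neg, L2.primitive_compLpL]
  rw [sub_neg_eq_add, eq_sub_iff_add_eq, ← sub_eq_iff_eq_add, add_sub_right_comm]

/-- The forward problem is well posed. -/
theorem L2.exists_forward_operator (hab : a < b) {c : ℝ} (hc : 0 < c)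
    (hR : ∀ u v, inner ℝ (R u) v = inner ℝ u (R v)) (hR0 : ∀ u, 0 ≤ inner ℝ (R u) u)
    (hK : ∀ u v, inner ℝ (K u) v = inner ℝ u (K v)) (hK0 : ∀ u, c * ‖u‖ ^ 2 ≤ inner ℝ (K u) u)
    (hA : ∀ u v, inner ℝ (A u) v = inner ℝ u (A v)) (hA0 : ∀ u, 0 ≤ inner ℝ (A u) u) :
    ∃ Λ : L2 E a b →L[ℝ] L2 E a b, ∀ F w, L2.SolvesForward R K A F w ↔ w = Λ F := by
  obtain ⟨Λ, hΛ⟩ := L2.exists_evolution_inverse (a := a) (b := b) hab hc hR hR0 hK hK0 hA hA0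
  refine ⟨Λ, fun F w => ⟨fun hw => ?_, fun hw => hw ▸ hΛ F⟩⟩
  exact L2.evolution_injective hab hc hR hR0 hK0 hA hA0 (hw.trans (hΛ F).symm)

/-- The backward problem is well posed. -/
theorem L2.existsUnique_solvesBackward (hab : a < b) {c : ℝ} (hc : 0 < c)
    (hR : ∀ u v, inner ℝ (R u) v = inner ℝ u (R v)) (hR0 : ∀ u, 0 ≤ inner ℝ (R u) u)
    (hK : ∀ u v, inner ℝ (K u) v = inner ℝ u (K v)) (hK0 : ∀ u, c * ‖u‖ ^ 2 ≤ inner ℝ (K u) u)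
    (hA : ∀ u v, inner ℝ (A u) v = inner ℝ u (A v)) (hA0 : ∀ u, 0 ≤ inner ℝ (A u) u)
    (F : L2 E a b) : ∃! w, L2.SolvesBackward R K A F w := by
  -- The load is negated because the adjoint of the primitive from a is minus the primitive from b.
  obtain ⟨w, hw⟩ := L2.exists_adjoint_evolution_eq hab hc hR hR0 hK0 hA hA0 (-F)
  rw [L2.adjoint_primitive, map_neg, neg_neg] at hw
  exact ⟨w, hw, fun w' hw' =>
    L2.adjoint_evolution_injective hab hc hR hR0 hK hK0 hA hA0 (hw'.trans hw.symm)⟩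

/-- Duality between the forward problem with load `f` and the backward problem with load `F`. -/
theorem L2.inner_forward_eq_inner_backward {F f x w : L2 E a b}
    (hx : L2.SolvesForward R K A f x) (hw : L2.SolvesBackward R K A F w) :
    inner ℝ F (L2.primitive E a b a x) = inner ℝ (L2.primitive E a b b w) f := by
  rw [L2.SolvesForward] at hx
  rw [L2.SolvesBackward] at hw
  -- Both sides equal −⟨L x, w⟩, where L is `L2.evolution R K A`.
  rw [real_inner_comm, L2.inner_primitive_left, ← hw, ContinuousLinearMap.adjoint_inner_right, hx,
    L2.inner_primitive_left, neg_neg, real_inner_comm]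

omit [CompleteSpace E] in
-- The summand `0 • e₁` is the vanishing end moment of the adjoint problem, kept to match the load
-- format of `isWeakBeamSolution_iff`.
theorem L2.coeFn_toSpanSingleton_compLpL_sub (e₀ e₁ : E) (p q : L2 ℝ a b) {x : ℝ → ℝ}
    (hx : ∀ᵐ t ∂volume.restrict (Ioo a b), x t = p t) :
    ∀ᵐ t ∂volume.restrict (Ioo a b),
      (ContinuousLinearMap.toSpanSingleton ℝ e₀).compLpL 2 _ (p - q) t
        = (0 : ℝ) • e₁ + (x t - q t) • e₀ := by
  filter_upwards [(ContinuousLinearMap.toSpanSingleton ℝ e₀).coeFn_compLpL (p - q), hx,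
    Lp.coeFn_sub p q] with t h1 h2 h3
  rw [h1, h3, Pi.sub_apply, h2, zero_smul, zero_add, ContinuousLinearMap.toSpanSingleton_apply]

/-- Loading along e and observing through ⟨e, ·⟩ are adjoint to each other. This lets tip
observation in one problem become tip loading in the other. -/
theorem L2.inner_toSpanSingleton_compLpL (e : E) (p : L2 ℝ a b) (f : L2 E a b) :
    inner ℝ ((ContinuousLinearMap.toSpanSingleton ℝ e).compLpL 2 _ p) f
      = inner ℝ p ((innerSL ℝ e).compLpL 2 _ f) := by
  rw [L2.inner_compLpL_left, ContinuousLinearMap.adjoint_toSpanSingleton]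

end Duality

/-! ### Well-posedness and the gradient -/

section Gradient

variable {ℓ T : ℝ}

/-- The operators of the forms `(ρ u, v)`, `±((μ u, v) + (κ u'', v''))` and `(r u'', v'')`. -/
theorem BasicConditions.exists_operators (hℓ : 0 < ℓ) {ρA μ r κ : ℝ → ℝ}
    {ρ₀ ρ₁ μ₀ μ₁ r₀ r₁ κ₀ κ₁ : ℝ}
    (hcoef : BasicConditions ℓ ρA μ r κ ρ₀ ρ₁ μ₀ μ₁ r₀ r₁ κ₀ κ₁) :
    ∃ (R K K' A : ClampedH2 ℓ →L[ℝ] ClampedH2 ℓ) (c : ℝ), 0 < c ∧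
      (∀ u v : ClampedH2 ℓ, inner ℝ (R u) v = weightedPairing ρA (u.1 0) (v.1 0)) ∧
      (∀ u v : ClampedH2 ℓ, inner ℝ (K u) v
        = weightedPairing μ (u.1 0) (v.1 0) + weightedPairing κ (u.1 2) (v.1 2)) ∧
      (∀ u v : ClampedH2 ℓ, inner ℝ (K' u) v
        = weightedPairing (fun x => -μ x) (u.1 0) (v.1 0)
          + weightedPairing (fun x => -κ x) (u.1 2) (v.1 2)) ∧
      (∀ u v : ClampedH2 ℓ, inner ℝ (A u) v = weightedPairing r (u.1 2) (v.1 2)) ∧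
      (∀ u, K' u = -K u) ∧
      (∀ u v, inner ℝ (R u) v = inner ℝ u (R v)) ∧ (∀ u, 0 ≤ inner ℝ (R u) u) ∧
      (∀ u v, inner ℝ (K u) v = inner ℝ u (K v)) ∧ (∀ u, c * ‖u‖ ^ 2 ≤ inner ℝ (K u) u) ∧
      (∀ u v, inner ℝ (A u) v = inner ℝ u (A v)) ∧ (∀ u, 0 ≤ inner ℝ (A u) u) := by
  obtain ⟨R, hR⟩ := exists_form_operator hℓ hcoef.memLp_ρA 0
  obtain ⟨K₀, hK₀⟩ := exists_form_operator hℓ hcoef.memLp_μ 0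
  obtain ⟨K₂, hK₂⟩ := exists_form_operator hℓ hcoef.memLp_κ 2
  obtain ⟨A, hA⟩ := exists_form_operator hℓ hcoef.memLp_r 2
  obtain ⟨C, hC, hpoincare⟩ := ClampedH2.exists_norm_sq_le hℓ
  obtain ⟨K, hK⟩ : ∃ K : ClampedH2 ℓ →L[ℝ] ClampedH2 ℓ, ∀ u v : ClampedH2 ℓ, inner ℝ (K u) v
      = weightedPairing μ (u.1 0) (v.1 0) + weightedPairing κ (u.1 2) (v.1 2) :=
    ⟨K₀ + K₂, fun u v => by rw [add_apply, inner_add_left, hK₀, hK₂]⟩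
  obtain ⟨K', hK'⟩ : ∃ K' : ClampedH2 ℓ →L[ℝ] ClampedH2 ℓ, ∀ u, K' u = -K u :=
    ⟨-K, fun _ => rfl⟩
  have hKneg : ∀ u v : ClampedH2 ℓ, inner ℝ (K' u) v
      = weightedPairing (fun x => -μ x) (u.1 0) (v.1 0)
        + weightedPairing (fun x => -κ x) (u.1 2) (v.1 2) := fun u v => by
    rw [hK', inner_neg_left, hK, weightedPairing_neg, weightedPairing_neg, neg_add]
  have sR : ∀ u v, inner ℝ (R u) v = inner ℝ u (R v) := fun u v => by
    rw [hR, real_inner_comm, hR, weightedPairing_comm]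
  have sA : ∀ u v, inner ℝ (A u) v = inner ℝ u (A v) := fun u v => by
    rw [hA, real_inner_comm, hA, weightedPairing_comm]
  have sK : ∀ u v, inner ℝ (K u) v = inner ℝ u (K v) := fun u v => by
    rw [hK, real_inner_comm, hK, weightedPairing_comm μ, weightedPairing_comm κ]
  have pR : ∀ u, 0 ≤ inner ℝ (R u) u := fun u => by
    rw [hR]
    refine le_trans ?_ (mul_norm_sq_le_weightedPairing hcoef.memLp_ρA (c := ρ₀)
      (hcoef.bounds.mono fun x hx => hx.1.1) _)
    exact mul_nonneg hcoef.ρ₀_pos.le (sq_nonneg _)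
  have pA : ∀ u, 0 ≤ inner ℝ (A u) u := fun u => by
    rw [hA]
    refine le_trans ?_ (mul_norm_sq_le_weightedPairing hcoef.memLp_r (c := r₀)
      (hcoef.bounds.mono fun x hx => hx.2.2.1.1) _)
    exact mul_nonneg hcoef.r₀_pos.le (sq_nonneg _)
  -- The Kelvin–Voigt term controls κ₀‖u″‖², and the Poincaré constant C turns this into the full
  -- norm of V; the viscous term need only be nonnegative.
  have hc : 0 < κ₀ / C := div_pos hcoef.κ₀_pos hC
  have pK : ∀ u, κ₀ / C * ‖u‖ ^ 2 ≤ inner ℝ (K u) u := fun u => by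
    rw [hK]
    have h1 := mul_norm_sq_le_weightedPairing hcoef.memLp_κ (c := κ₀)
      (hcoef.bounds.mono fun x hx => hx.2.2.2.1) (u.1 2)
    have h2 := mul_norm_sq_le_weightedPairing hcoef.memLp_μ (c := μ₀)
      (hcoef.bounds.mono fun x hx => hx.2.1.1) (u.1 0)
    have h3 : κ₀ / C * ‖u‖ ^ 2 ≤ κ₀ * ‖u.1 2‖ ^ 2 := by
      rw [div_mul_eq_mul_div, div_le_iff₀ hC, mul_assoc, mul_comm _ C]
      exact mul_le_mul_of_nonneg_left (hpoincare u) hcoef.κ₀_pos.le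
    have h4 := mul_nonneg hcoef.μ₀_nonneg (sq_nonneg ‖u.1 0‖)
    linarith
  exact ⟨R, K, K', A, κ₀ / C, hc, hR, hK, hKneg, hA, hK', sR, pR, sK, pK, sA, pA⟩

/-- A motion at rest at time c is determined by its velocity, so unique solvability for the velocity
transfers to the motion. -/
theorem existsUnique_of_iff_velocity (hℓ : 0 < ℓ) (hT : 0 < T) {c : ℝ} (hc : c ∈ Icc 0 T)
    {Q : BeamClass ℓ T → Prop} {S : L2 (ClampedH2 ℓ) 0 T → Prop}
    (hQ : ∀ u, Q u ↔ u.1 0 = L2.primitive _ 0 T c (u.1 1) ∧ S (u.1 1)) (hS : ∃! w, S w) :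
    ∃! u, Q u := by
  obtain ⟨w, hw, huniq⟩ := hS
  refine ⟨BeamClass.ofVelocity hℓ hT hc w, (hQ _).2 ⟨rfl, hw⟩, fun v hv => ?_⟩
  have h := (hQ v).1 hv
  exact BeamClass.ext_velocity h.1 rfl (huniq _ h.2)

/-- The load `g ↦ g(t) e` as an operator. -/
def ForceSpace.load {E : Type*} [NormedAddCommGroup E] [InnerProductSpace ℝ E] (T : ℝ) (e : E) :
    ForceSpace T →L[ℝ] L2 E 0 T :=
  (ContinuousLinearMap.toSpanSingleton ℝ e).compLpL 2 _ ∘L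
    (PiLp.proj 2 (𝕜 := ℝ) (fun _ : Fin 2 => L2 ℝ 0 T) 0 ∘L (ForceSpace T).subtypeL)

theorem ForceSpace.inner_load {E : Type*} [NormedAddCommGroup E] [InnerProductSpace ℝ E]
    [CompleteSpace E] (e : E) (d : ForceSpace T) (f : L2 E 0 T) :
    inner ℝ f (ForceSpace.load T e d) = integralFunctional ((innerSL ℝ e).compLpL 2 _ f) d := by
  rw [real_inner_comm]
  exact (L2.inner_toSpanSingleton_compLpL e (d.1 0) f).trans (real_inner_comm _ _)

theorem ForceSpace.coeFn_load {E : Type*} [NormedAddCommGroup E] [InnerProductSpace ℝ E]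
    (m : ℝ) (e₀ e₁ : E) (d : ForceSpace T) :
    ∀ᵐ t ∂volume.restrict (Ioo 0 T), ForceSpace.load T (m • e₁ + e₀) d t
      = (m * d.1 0 t) • e₁ + d.1 0 t • e₀ := by
  filter_upwards [(ContinuousLinearMap.toSpanSingleton ℝ (m • e₁ + e₀)).coeFn_compLpL (d.1 0)]
    with t ht
  refine ht.trans ?_
  rw [ContinuousLinearMap.toSpanSingleton_apply, smul_add, smul_smul, mul_comm]

theorem tip_ae_eq {e₀ : ClampedH2 ℓ} (he : ∀ v : ClampedH2 ℓ, valueAt (v.1 0) ℓ = inner ℝ e₀ v)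
    (u : BeamClass ℓ T) :
    ∀ᵐ t ∂volume.restrict (Ioo 0 T), tip u t = (innerSL ℝ e₀).compLpL 2 _ (u.1 0) t := by
  filter_upwards [(innerSL ℝ e₀).coeFn_compLpL (u.1 0)] with t ht
  rw [ht, tip, he, innerSL_apply_apply]

theorem L2.coeFn_inner_add_smul_compLpL {E : Type*} [NormedAddCommGroup E] [InnerProductSpace ℝ E]
    (e₀ e₁ : E) (m : ℝ) (f : L2 E 0 T) :
    ∀ᵐ t ∂volume.restrict (Ioo 0 T),
      (innerSL ℝ (m • e₁ + e₀)).compLpL 2 _ f t = inner ℝ e₀ (f t) + m * inner ℝ e₁ (f t) := by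
  filter_upwards [(innerSL ℝ (m • e₁ + e₀)).coeFn_compLpL f] with t ht
  rw [ht, innerSL_apply_apply, inner_add_left, real_inner_smul_left, add_comm]

theorem tip_add_tipSlope_ae_eq {e₀ e₁ : ClampedH2 ℓ}
    (he : ∀ v : ClampedH2 ℓ, valueAt (v.1 0) ℓ = inner ℝ e₀ v ∧ valueAt (v.1 1) ℓ = inner ℝ e₁ v)
    (m : ℝ) (u : BeamClass ℓ T) :
    ∀ᵐ t ∂volume.restrict (Ioo 0 T),
      (innerSL ℝ (m • e₁ + e₀)).compLpL 2 _ (u.1 0) t = tip u t + m * tipSlope u t := by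
  filter_upwards [L2.coeFn_inner_add_smul_compLpL e₀ e₁ m (u.1 0)] with t ht
  rw [ht, tip, tipSlope, (he _).1, (he _).2]

theorem hasFDerivAt_half_norm_sq_sub {G H : Type*} [NormedAddCommGroup G] [NormedSpace ℝ G]
    [NormedAddCommGroup H] [InnerProductSpace ℝ H] (B : G →L[ℝ] H) (n : H) (g : G)
    {D : G →L[ℝ] ℝ} (hD : ∀ d, D d = inner ℝ (B g - n) (B d)) :
    HasFDerivAt (fun x => 1 / 2 * ‖B x - n‖ ^ 2) D g := by
  have h := ((B.hasFDerivAt (x := g)).sub_const n).norm_sq.const_mul (1 / 2 : ℝ)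
  refine h.congr_fderiv ?_
  ext d
  rw [hD]
  simp [inner_sub_left]

end Gradient

end

/-! ### Well-posedness and the gradient formula for the beam -/

theorem theorem3 (ℓ T h θ : ℝ) (hℓ : 0 < ℓ) (hT : 0 < T) (hh : 0 < h) (hθ : 0 < θ)
    (ρA μ r κ : ℝ → ℝ) (ρ₀ ρ₁ μ₀ μ₁ r₀ r₁ κ₀ κ₁ : ℝ)
    (hcoef : BasicConditions ℓ ρA μ r κ ρ₀ ρ₁ μ₀ μ₁ r₀ r₁ κ₀ κ₁)
    (ν : Sobolev 1 ℝ 0 T) :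
    (∀ g : ForceSpace T, ∃! u : BeamClass ℓ T, IsDirectSolution ℓ T h θ ρA μ r κ g u) ∧
    Differentiable ℝ (tikhonov ℓ T h θ ρA μ r κ ν) ∧
    ∀ g : ForceSpace T,
      (∃! φ : BeamClass ℓ T, IsBackwardSolution ℓ T ρA μ r κ
        (fun t => tip (directSolution ℓ T h θ ρA μ r κ g) t - ν.1 0 t) φ) ∧
      ∀ φ : BeamClass ℓ T, IsBackwardSolution ℓ T ρA μ r κ
          (fun t => tip (directSolution ℓ T h θ ρA μ r κ g) t - ν.1 0 t) φ →
        ∃ G : L2 ℝ 0 T,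
          (∀ᵐ t ∂volume.restrict (Ioo 0 T), G t = tip φ t + momentFactor h θ * tipSlope φ t) ∧
          HasFrechetGradientAt (tikhonov ℓ T h θ ρA μ r κ ν) G g := by
  have := ClampedH2.completeSpace hℓ
  obtain ⟨R, K, K', A, c, hc, hR, hK, hKneg, hA, hK', sR, pR, sK, pK, sA, pA⟩ :=
    hcoef.exists_operators hℓ
  obtain ⟨e₀, e₁, he⟩ := ClampedH2.exists_valueAt_eq_inner hℓ
  obtain ⟨Λ, hΛ⟩ := L2.exists_forward_operator (a := 0) (b := T) hT hc sR pR sK pK sA pA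
  -- Moment and shear are both multiples of g, so they form one load g(t) e; pairing φ with the same
  -- e produces the gradient φ(ℓ,t) + C_θ φ_x(ℓ,t).
  set e := momentFactor h θ • e₁ + e₀
  have hl : (0 : ℝ) ∈ Icc 0 T := left_mem_Icc.2 hT.le
  have hr : T ∈ Icc 0 T := right_mem_Icc.2 hT.le
  have hdirect : ∀ (g : ForceSpace T) (u : BeamClass ℓ T), IsDirectSolution ℓ T h θ ρA μ r κ g u ↔
      u.1 0 = L2.primitive _ 0 T 0 (u.1 1) ∧
        L2.SolvesForward R K A (ForceSpace.load T e g) (u.1 1) := fun g u => by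
    rw [IsDirectSolution, isWeakBeamSolution_iff hℓ hT hR hK hA he hl
      (F := ForceSpace.load T e g)]
    · exact and_congr_right fun hu => L2.forward_iff hu
    · exact ForceSpace.coeFn_load _ e₀ e₁ g
  have hex : ∀ g : ForceSpace T, ∃! u : BeamClass ℓ T, IsDirectSolution ℓ T h θ ρA μ r κ g u :=
    fun g => existsUnique_of_iff_velocity hℓ hT hl
      (S := L2.SolvesForward R K A (ForceSpace.load T e g)) (hdirect g)
      ⟨Λ (ForceSpace.load T e g), (hΛ _ _).2 rfl, fun w hw => (hΛ _ _).1 hw⟩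
  -- The input-to-output map: load, velocity, displacement, value at the tip.
  set B : ForceSpace T →L[ℝ] L2 ℝ 0 T := (innerSL ℝ e₀).compLpL 2 _ ∘L
    L2.primitive _ 0 T 0 ∘L Λ ∘L ForceSpace.load T e
  have hsol : ∀ g : ForceSpace T, ∀ᵐ t ∂volume.restrict (Ioo 0 T),
      tip (directSolution ℓ T h θ ρA μ r κ g) t = B g t := fun g => by
    have hs : IsDirectSolution ℓ T h θ ρA μ r κ g (directSolution ℓ T h θ ρA μ r κ g) := by
      rw [directSolution, dif_pos (hex g).exists]
      exact (hex g).exists.choose_spec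
    have h1 := (hdirect g _).1 hs
    have h2 := (hΛ _ _).1 h1.2
    have h3 := tip_ae_eq (fun v => (he v).1) (directSolution ℓ T h θ ρA μ r κ g)
    rw [h1.1, h2] at h3
    exact h3
  have hJ : tikhonov ℓ T h θ ρA μ r κ ν = fun g => 1 / 2 * ‖B g - ν.1 0‖ ^ 2 := by
    funext g
    rw [tikhonov, ← real_inner_self_eq_norm_sq, L2.inner_def]
    congr 1
    refine integral_congr_ae ?_
    filter_upwards [hsol g, Lp.coeFn_sub (B g) (ν.1 0)] with t h1 h2
    rw [h1, h2, Pi.sub_apply, real_inner_self_eq_norm_sq, Real.norm_eq_abs, sq_abs]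
  have hback : ∀ (g : ForceSpace T) (φ : BeamClass ℓ T), IsBackwardSolution ℓ T ρA μ r κ
      (fun t => tip (directSolution ℓ T h θ ρA μ r κ g) t - ν.1 0 t) φ ↔
      φ.1 0 = L2.primitive _ 0 T T (φ.1 1) ∧
        L2.SolvesBackward R K A
          ((ContinuousLinearMap.toSpanSingleton ℝ e₀).compLpL 2 _ (B g - ν.1 0)) (φ.1 1) := fun g φ => by
    refine (isWeakBeamSolution_iff hℓ hT hR hKneg hA he hr
      (F := (ContinuousLinearMap.toSpanSingleton ℝ e₀).compLpL 2 _ (B g - ν.1 0)) ?_ φ).trans ?_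
    rotate_left
    · exact and_congr_right fun hu => L2.backward_iff sR sK sA hK' hu
    · exact L2.coeFn_toSpanSingleton_compLpL_sub e₀ e₁ (B g) (ν.1 0) (hsol g)
  have hexb : ∀ g : ForceSpace T, ∃! φ : BeamClass ℓ T, IsBackwardSolution ℓ T ρA μ r κ
      (fun t => tip (directSolution ℓ T h θ ρA μ r κ g) t - ν.1 0 t) φ := fun g =>
    existsUnique_of_iff_velocity hℓ hT hr (hback g)
      (L2.existsUnique_solvesBackward hT hc sR pR sK pK sA pA _)
  have hgrad : ∀ (g : ForceSpace T) (φ : BeamClass ℓ T), IsBackwardSolution ℓ T ρA μ r κ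
      (fun t => tip (directSolution ℓ T h θ ρA μ r κ g) t - ν.1 0 t) φ →
      HasFrechetGradientAt (tikhonov ℓ T h θ ρA μ r κ ν)
        ((innerSL ℝ e).compLpL 2 _ (φ.1 0)) g := fun g φ hφ => by
    obtain ⟨h0, hw⟩ := (hback g φ).1 hφ
    rw [HasFrechetGradientAt, hJ]
    refine hasFDerivAt_half_norm_sq_sub B _ g fun d => ?_
    -- The forward problem carries the increment d along e, the backward one the output residual
    -- along e₀; duality identifies ⟨B g − ν, B d⟩ with the integral of ⟨e, φ⟩ d.
    have h1 := L2.inner_forward_eq_inner_backward ((hΛ (ForceSpace.load T e d) _).2 rfl) hw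
    rw [L2.inner_toSpanSingleton_compLpL, ← h0, ForceSpace.inner_load] at h1
    exact h1.symm
  refine ⟨hex, fun g => ?_, fun g => ⟨hexb g, fun φ hφ => ⟨_, ?_, hgrad g φ hφ⟩⟩⟩
  · obtain ⟨φ, hφ, -⟩ := hexb g
    exact (hgrad g φ hφ).differentiableAt
  · exact tip_add_tipSlope_ae_eq he _ φ
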